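/- Let $d$ be a natural number and let $u\in\mathscr S'(\mathbb R^d)$ be a tempered distribution. Write $\langle z\rangle=(1+|z|^2)^{1/2}$ for $z=(x,\xi)\in T^*(\mathbb R^d)=\mathbb R^{2d}$, and call a subset of $\mathbb R^{2d}\setminus\{0\}$ conic if it is invariant under multiplication by positive reals. Let $(\cdot,\cdot)$ denote the action of $\mathscr S'$ on $\mathscr S$ that is conjugate linear in the second argument and extends the $L^2$ inner product. For $m\in\mathbb R$ let $G^m$ be the set of all $a\in C^\infty(\mathbb R^{2d})$ such that for every multi-index $\gamma\in\mathbb N^{2d}$ there is a constant $C_\gamma>0$ with $|\partial^\gamma a(z)|\le C_\gamma\langle z\rangle^{m-|\gamma|}$ for all $z\in\mathbb R^{2d}$. For $a\in G^m$ the Weyl operator is $$a^w(x,D)f(x)=(2\pi)^{-d}\int_{\mathbb R^d}\Big(\int_{\mathbb R^d}e^{i\langle x-y,\xi\rangle}\,a\Big(\frac{x+y}2,\xi\Big)f(y)\,dy\Big)d\xi,\qquad f\in\mathscr S(\mathbb R^d),$$ which maps $\mathscr S(\mathbb R^d)$ to itself and is extended to $\mathscr S'(\mathbb R^d)$ by duality,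 $(a^w(x,D)u,g)=(u,\overline a^{\,w}(x,D)g)$ for $g\in\mathscr S(\mathbb R^d)$. The characteristic set $\operatorname{char}(a)$ of $a\in G^m$ is the set of all $z_0\in\mathbb R^{2d}\setminus\{0\}$ for which there do not exist $A,\varepsilon>0$ and an open conic set $\Gamma\subseteq\mathbb R^{2d}\setminus\{0\}$ containing $z_0$ such that $|a(z)|\ge\varepsilon\langle z\rangle^m$ for all $z\in\Gamma$ with $|z|\ge A$. Hörmander's global wave front set $WF(u)$ is the set of all $z_0\in\mathbb R^{2d}\setminus\{0\}$ such that $z_0\in\operatorname{char}(a)$ whenever $m\in\mathbb R$, $a\in G^m$ and $a^w(x,D)u\in\mathscr S(\mathbb R^d)$. For a window $\varphi\in\mathscr S(\mathbb R^d)\setminus\{0\}$ let $V_\varphi u(x,\xi)=(u,\,e^{i\langle\cdot,\xi\rangle}\varphi(\cdot-x))$ be the short-time Fourier transform of $u$, and let $WF'(u)$ be the set of all $z_0\in\mathbb R^{2d}\setminus\{0\}$ for which there is no open conic set $\Gamma\subseteq\mathbb R^{2d}\setminus\{0\}$ containing $z_0$ such that $\sup_{z\in\Gamma}\langle z\rangle^N|V_\varphi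 u(z)|<\infty$ for all $N\ge0$. Then, for every window $\varphi\in\mathscr S(\mathbb R^d)\setminus\{0\}$, $$WF'(u)\subseteq WF(u).$$ -/

import Mathlib

open MeasureTheory
open scoped SchwartzMap ContDiff ComplexConjugate

noncomputable section

namespace GlobalWF

/-- The configuration space `ℝ^d` with its Euclidean structure. -/
abbrev Space (d : ℕ) : Type := EuclideanSpace ℝ (Fin d)

/-- The phase space `T^*(ℝ^d) = ℝ^{2d}`, with points `z = (x, ξ)`. -/
abbrev PhaseSpace (d : ℕ) : Type := Space d × Space d

variable {d : ℕ}

/-- The Euclidean norm `|z| = (|x|² + |ξ|²)^{1/2}` of `z = (x, ξ)`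
(the norm that Mathlib puts on a product is the maximum norm). -/
def phaseNorm (z : PhaseSpace d) : ℝ := Real.sqrt (‖z.1‖ ^ 2 + ‖z.2‖ ^ 2)

/-- `⟨z⟩ = (1 + |z|²)^{1/2}`. -/
def japaneseBracket (z : PhaseSpace d) : ℝ := Real.sqrt (1 + phaseNorm z ^ 2)

/-- `Γ` is an open conic subset of `T^*(ℝ^d) \ {(0,0)}`. -/
def IsOpenCone (Γ : Set (PhaseSpace d)) : Prop :=
  IsOpen Γ ∧ (0 : PhaseSpace d) ∉ Γ ∧ ∀ z ∈ Γ, ∀ t : ℝ, 0 < t → t • z ∈ Γ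

/-! ### Time-frequency shifts and the short-time Fourier transform -/

theorem hasTemperateGrowth_cexp_mul_I :
    Function.HasTemperateGrowth (fun t : ℝ => Complex.exp (t * Complex.I)) := by
  have key : ∀ n : ℕ, iteratedDeriv n (fun t : ℝ => Complex.exp (t * Complex.I)) =
      fun t : ℝ => Complex.I ^ n * Complex.exp (t * Complex.I) := by
    intro n
    induction n with
    | zero => simp
    | succ n ih =>
      rw [iteratedDeriv_succ, ih]
      funext t
      have h : HasDerivAt (fun t : ℝ => Complex.exp (t * Complex.I))
          (Complex.exp (t * Complex.I) * (1 * Complex.I)) t :=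
        ((Complex.ofRealCLM.hasDerivAt (x := t)).mul_const Complex.I).cexp
      rw [(h.const_mul (Complex.I ^ n)).deriv]
      ring
  refine ⟨?_, fun n => ⟨0, 1, fun t => ?_⟩⟩
  · exact ((Complex.ofRealCLM.contDiff).mul contDiff_const).cexp
  · rw [norm_iteratedFDeriv_eq_norm_iteratedDeriv, key]
    simp [Complex.norm_exp_ofReal_mul_I]

theorem hasTemperateGrowth_modulation (ξ : Space d) :
    Function.HasTemperateGrowth
      (fun y : Space d => Complex.exp ((inner ℝ y ξ : ℝ) * Complex.I)) :=
  hasTemperateGrowth_cexp_mul_I.comp (Function.hasTemperateGrowth_inner_left ξ)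

/-- The phase space translation `Π(z) φ = M_ξ T_x φ` of a Schwartz function, `z = (x, ξ)`. -/
def phaseShift (z : PhaseSpace d) (φ : 𝓢(Space d, ℂ)) : 𝓢(Space d, ℂ) :=
  SchwartzMap.smulLeftCLM ℂ (fun y : Space d => Complex.exp ((inner ℝ y z.2 : ℝ) * Complex.I))
    (SchwartzMap.compSubConstCLM ℂ z.1 φ)

theorem phaseShift_apply (z : PhaseSpace d) (φ : 𝓢(Space d, ℂ)) (y : Space d) :
    phaseShift z φ y = Complex.exp ((inner ℝ y z.2 : ℝ) * Complex.I) * φ (y - z.1) := by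
  rw [phaseShift, SchwartzMap.smulLeftCLM_apply_apply (hasTemperateGrowth_modulation z.2)]
  simp

/-- The complex conjugate of a Schwartz function. -/
def conjSchwartz (g : 𝓢(Space d, ℂ)) : 𝓢(Space d, ℂ) :=
  SchwartzMap.postcompCLM (Complex.conjCLE : ℂ →L[ℝ] ℂ) g

theorem conjSchwartz_apply (g : 𝓢(Space d, ℂ)) (y : Space d) :
    conjSchwartz g y = conj (g y) := rfl

/-- The action `(u, g)` of `u ∈ 𝓢'` on `g ∈ 𝓢`, conjugate linear in `g` and consistent with the
`L²` inner product (Mathlib's `u g` is the bilinear action). -/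
def pairing (u : 𝓢'(Space d, ℂ)) (g : 𝓢(Space d, ℂ)) : ℂ := u (conjSchwartz g)

/-- The short-time Fourier transform `V_φ u(z) = (u, Π(z) φ)`. -/
def stft (φ : 𝓢(Space d, ℂ)) (u : 𝓢'(Space d, ℂ)) (z : PhaseSpace d) : ℂ :=
  pairing u (phaseShift z φ)

/-- The wave front set `WF'(u)`, computed with the window `φ`: a point `z₀ ≠ 0` is outside it iff
`V_φ u` decays rapidly in some open conic set containing `z₀`. -/
def stftWaveFrontSet (φ : 𝓢(Space d, ℂ)) (u : 𝓢'(Space d, ℂ)) : Set (PhaseSpace d) :=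
  {z₀ | z₀ ≠ 0 ∧ ¬ ∃ Γ : Set (PhaseSpace d), IsOpenCone Γ ∧ z₀ ∈ Γ ∧
    ∀ N : ℕ, BddAbove ((fun z => japaneseBracket z ^ N * ‖stft φ u z‖) '' Γ)}

/-! ### Shubin symbols and the Weyl quantization -/

/-- The Shubin class `G^m`: smooth `a` with `|∂^γ a(z)| ≤ C_γ ⟨z⟩^{m - |γ|}` for all multi-indices
`γ`. The partial derivatives of order `n` are controlled together, through the norm of the `n`-th
total derivative. -/
def ShubinClass (m : ℝ) (a : PhaseSpace d → ℂ) : Prop :=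
  ContDiff ℝ ∞ a ∧ ∀ n : ℕ, ∃ C : ℝ, ∀ z : PhaseSpace d,
    ‖iteratedFDeriv ℝ n a z‖ ≤ C * japaneseBracket z ^ (m - n)

/-- The characteristic set of `a ∈ G^m`: the points `z₀ ≠ 0` that are not non-characteristic. -/
def charSet (m : ℝ) (a : PhaseSpace d → ℂ) : Set (PhaseSpace d) :=
  {z₀ | z₀ ≠ 0 ∧ ¬ ∃ (A ε : ℝ) (Γ : Set (PhaseSpace d)), 0 < A ∧ 0 < ε ∧ IsOpenCone Γ ∧ z₀ ∈ Γ ∧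
    ∀ z ∈ Γ, A ≤ phaseNorm z → ε * japaneseBracket z ^ m ≤ ‖a z‖}

/-- The value at `x` of `a^w(x,D) f`,
`(2π)^{-d} ∫ (∫ e^{i⟨x-y,ξ⟩} a((x+y)/2, ξ) f(y) dy) dξ`.
For `a` in a Shubin class and `f ∈ 𝓢` both integrals of this iterated integral converge absolutely,
since the inner one decays rapidly in `ξ`. -/
def weylValue (a : PhaseSpace d → ℂ) (f : 𝓢(Space d, ℂ)) (x : Space d) : ℂ :=
  ((2 * Real.pi) ^ d : ℝ)⁻¹ • ∫ ξ : Space d, ∫ y : Space d,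
    Complex.exp ((inner ℝ (x - y) ξ : ℝ) * Complex.I) * a ((2⁻¹ : ℝ) • (x + y), ξ) * f y

open Classical in
/-- `a^w(x,D) f` as an element of `𝓢`. For `a` in a Shubin class and `f ∈ 𝓢` the function
`weylValue a f` is a Schwartz function, so that the second branch concerns other symbols only. -/
def weylOp (a : PhaseSpace d → ℂ) (f : 𝓢(Space d, ℂ)) : 𝓢(Space d, ℂ) :=
  if h : ∃ g : 𝓢(Space d, ℂ), ∀ x, g x = weylValue a f x then h.choose else 0

/-- The functional `g ↦ (a^w(x,D) u, g) = (u, \bar a^w(x,D) g)`: the Weyl quantization on `𝓢'`,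
defined by duality from the one on `𝓢`. -/
def weylDual (a : PhaseSpace d → ℂ) (u : 𝓢'(Space d, ℂ)) (g : 𝓢(Space d, ℂ)) : ℂ :=
  pairing u (weylOp (fun z => conj (a z)) g)

/-- `a^w(x,D) u ∈ 𝓢`. -/
def WeylMemSchwartz (a : PhaseSpace d → ℂ) (u : 𝓢'(Space d, ℂ)) : Prop :=
  ∃ f : 𝓢(Space d, ℂ), ∀ g : 𝓢(Space d, ℂ),
    weylDual a u g = pairing (SchwartzMap.toTemperedDistributionCLM (Space d) ℂ volume f) g

/-- Hörmander's global wave front set `WF(u)`: the points `z₀ ≠ 0` that are characteristic for every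
`a ∈ G^m`, `m ∈ ℝ`, such that `a^w(x,D) u ∈ 𝓢`. -/
def waveFrontSet (u : 𝓢'(Space d, ℂ)) : Set (PhaseSpace d) :=
  {z₀ | z₀ ≠ 0 ∧ ∀ (m : ℝ) (a : PhaseSpace d → ℂ), ShubinClass m a → WeylMemSchwartz a u →
    z₀ ∈ charSet m a}

end GlobalWF

end

/-! Suppose `a ∈ G^m` satisfies `|a(z)| ≥ ε⟨z⟩^m` for large `z` in a cone and `a^w u = f ∈ 𝓢`; put
`b = conj a`. It suffices to show that `V_φ u` decays rapidly on the elliptic set. No symbolic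
calculus, cutoff or change of window is needed: the parametrix is built separately at each point `z`
and applied to the window only.

The Weyl quantization is covariant, `b^w Π(z) = Π(z) b(z + ·)^w` (`weylValue_phaseShift`). Since
each derivative of `b` gains a power of `⟨z⟩⁻¹`, at an elliptic point `b(z + w) = b(z) (1 + ⟨z⟩⁻¹
q_z(w))`, where `q_z` has polynomial growth in `w` with constants independent of `z`
(`ShubinClass.exists_symbolBound_translate`, by Peetre's inequality). Hence `q_z^w` is bounded on
`𝓢` uniformly in `z` (`exists_schwartzNorm_weylOp_le`), and a truncated Neumann series gives `b(z +
·)^w h_z = φ + r_z` with `h_z = O(|b(z)|⁻¹)` and `r_z = O(⟨z⟩⁻ⁿ)` in every Schwartz norm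
(`ShubinClass.exists_parametrix`).

Therefore `V_φ u(z) = (u, b^w Π(z) h_z) - (u, Π(z) r_z) = (f, Π(z) h_z) - (u, Π(z) r_z)`. The first
term decays rapidly because `f` is Schwartz and the windows `h_z` grow at most polynomially
(`exists_norm_innerPhaseShift_le`); the second is small because `u` is of finite order and `n` is
arbitrary.

The bulk of the work is the uniform continuity of `q^w` on `𝓢`. It rests on the identities `∂_v q^w
f = (∂_{(v,0)} q)^w f + q^w ∂_v f` and `⟨x, w⟩ q^w f = q^w (⟨·, w⟩ f) + i (∂_{(0,w)} q)^w f`,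
iterated over a class of symbols that is stable under differentiation. -/

noncomputable section

namespace GlobalWF

open scoped LineDeriv

variable {d : ℕ}

/-! ### Uniform estimates in the Schwartz space -/

/-- The increasing sequence of norms that defines the topology of `𝓢(ℝ^d)`. -/
def schwartzNorm (j : ℕ) : Seminorm ℂ 𝓢(Space d, ℂ) :=
  (Finset.Iic (j, j)).sup fun m : ℕ × ℕ => SchwartzMap.seminorm ℂ m.1 m.2

theorem schwartzNorm_nonneg (j : ℕ) (f : 𝓢(Space d, ℂ)) : 0 ≤ schwartzNorm j f :=
  apply_nonneg _ _

theorem schwartzNorm_mono {i j : ℕ} (h : i ≤ j) (f : 𝓢(Space d, ℂ)) :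
    schwartzNorm i f ≤ schwartzNorm j f :=
  Seminorm.le_def.1 (Finset.sup_mono (Finset.Iic_subset_Iic.2 (Prod.mk_le_mk.2 ⟨h, h⟩))) f

theorem one_add_pow_mul_le_schwartzNorm {j k n : ℕ} (hk : k ≤ j) (hn : n ≤ j)
    (f : 𝓢(Space d, ℂ)) (x : Space d) :
    (1 + ‖x‖) ^ k * ‖iteratedFDeriv ℝ n f x‖ ≤ 2 ^ j * schwartzNorm j f :=
  SchwartzMap.one_add_le_sup_seminorm_apply (𝕜 := ℂ) (m := (j, j)) hk hn f x

theorem pow_mul_le_schwartzNorm {j k n : ℕ} (hk : k ≤ j) (hn : n ≤ j)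
    (f : 𝓢(Space d, ℂ)) (x : Space d) :
    ‖x‖ ^ k * ‖iteratedFDeriv ℝ n f x‖ ≤ schwartzNorm j f :=
  (SchwartzMap.le_seminorm ℂ k n f x).trans
    (Seminorm.le_def.1 (Finset.le_sup (s := Finset.Iic (j, j)) (b := (k, n))
      (f := fun m : ℕ × ℕ => (SchwartzMap.seminorm ℂ m.1 m.2 : Seminorm ℂ 𝓢(Space d, ℂ)))
      (Finset.mem_Iic.2 (Prod.mk_le_mk.2 ⟨hk, hn⟩))) f)

theorem one_add_pow_mul_norm_le {j k : ℕ} (hk : k ≤ j) (f : 𝓢(Space d, ℂ)) (x : Space d) :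
    (1 + ‖x‖) ^ k * ‖f x‖ ≤ 2 ^ j * schwartzNorm j f := by
  simpa using one_add_pow_mul_le_schwartzNorm hk (Nat.zero_le j) f x

theorem schwartzNorm_le {j : ℕ} {f : 𝓢(Space d, ℂ)} {c : ℝ} (hc : 0 ≤ c)
    (h : ∀ k ≤ j, ∀ n ≤ j, ∀ x, ‖x‖ ^ k * ‖iteratedFDeriv ℝ n f x‖ ≤ c) :
    schwartzNorm j f ≤ c := by
  refine Seminorm.finset_sup_apply_le hc fun i hi => ?_
  obtain ⟨h1, h2⟩ := Prod.mk_le_mk.1 (Finset.mem_Iic.1 hi)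
  exact SchwartzMap.seminorm_le_bound ℂ _ _ f hc fun x => h _ h1 _ h2 x

/-- Estimates of the single derivatives, uniform up to powers of a weight, give estimates of the
norms. -/
theorem exists_schwartzNorm_le {ι : Type*} {w : ι → ℝ} (hw : ∀ i, 1 ≤ w i)
    {T : ι → 𝓢(Space d, ℂ) → 𝓢(Space d, ℂ)}
    (h : ∀ k n : ℕ, ∃ (C : ℝ) (K j : ℕ), ∀ i f x,
      ‖x‖ ^ k * ‖iteratedFDeriv ℝ n (T i f) x‖ ≤ C * w i ^ K * schwartzNorm j f) (j : ℕ) :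
    ∃ (C : ℝ) (K j' : ℕ), 0 ≤ C ∧ ∀ i f,
      schwartzNorm j (T i f) ≤ C * w i ^ K * schwartzNorm j' f := by
  choose C K J h using h
  let s := Finset.range (j + 1) ×ˢ Finset.range (j + 1)
  refine ⟨∑ p ∈ s, |C p.1 p.2|, s.sup fun p => K p.1 p.2, s.sup fun p => J p.1 p.2,
    by positivity, fun i f => ?_⟩
  have hwi : 0 ≤ w i := by linarith [hw i]
  refine schwartzNorm_le (by have := schwartzNorm_nonneg (s.sup fun p => J p.1 p.2) f
                             positivity) fun k hk n hn x => (h k n i f x).trans ?_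
  have hs : (k, n) ∈ s := by simp [s]; omega
  have h1 : C k n ≤ ∑ p ∈ s, |C p.1 p.2| := (le_abs_self _).trans
    (Finset.single_le_sum (f := fun p : ℕ × ℕ => |C p.1 p.2|) (fun _ _ => abs_nonneg _) hs)
  have h2 : w i ^ K k n ≤ w i ^ s.sup fun p => K p.1 p.2 :=
    pow_le_pow_right₀ (hw i) (Finset.le_sup (f := fun p : ℕ × ℕ => K p.1 p.2) hs)
  have h3 : schwartzNorm (J k n) f ≤ schwartzNorm (s.sup fun p => J p.1 p.2) f :=
    schwartzNorm_mono (Finset.le_sup (f := fun p : ℕ × ℕ => J p.1 p.2) hs) f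
  have h4 := schwartzNorm_nonneg (J k n) f
  gcongr

/-- The derivative of order `n + 1` is controlled by the derivatives of order `n` of the derivatives
in all directions of length at most one. -/
theorem norm_iteratedFDeriv_succ_le {E F : Type*} [NormedAddCommGroup E] [NormedSpace ℝ E]
    [NormedAddCommGroup F] [NormedSpace ℝ F] {g : E → F} (hg : ContDiff ℝ ∞ g) (n : ℕ) (x : E)
    {c : ℝ} (h : ∀ v : E, ‖v‖ ≤ 1 → ‖iteratedFDeriv ℝ n (fun y => fderiv ℝ g y v) x‖ ≤ c) :
    ‖iteratedFDeriv ℝ (n + 1) g x‖ ≤ c := by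
  have hc : 0 ≤ c := (norm_nonneg _).trans (h 0 (by simp))
  have key : ∀ m : Fin (n + 1) → E, iteratedFDeriv ℝ (n + 1) g x m =
      iteratedFDeriv ℝ n (fun y => fderiv ℝ g y (m (Fin.last n))) x (Fin.init m) := by
    intro m
    rw [iteratedFDeriv_succ_apply_right]
    have := (ContinuousLinearMap.apply ℝ F (m (Fin.last n))).iteratedFDeriv_comp_left
      (f := fderiv ℝ g) (x := x) (i := n) (n := ∞)
      (hg.fderiv_right (m := ∞) (by simp)).contDiffAt (by exact_mod_cast le_top)
    have h2 : (⇑(ContinuousLinearMap.apply ℝ F (m (Fin.last n))) ∘ fderiv ℝ g) =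
      fun y => fderiv ℝ g y (m (Fin.last n)) := by ext y; simp
    rw [h2] at this
    rw [this]
    simp
  -- The hypothesis covers the unit ball only; linearity of the derivative in `v` extends it to all
  -- directions.
  have hunit : ∀ v : E, ∀ m : Fin n → E,
      ‖iteratedFDeriv ℝ n (fun y => fderiv ℝ g y v) x m‖ ≤ c * ‖v‖ * ∏ i, ‖m i‖ := by
    intro v m
    rcases eq_or_ne v 0 with rfl | hv
    · have : (fun y => fderiv ℝ g y (0 : E)) = 0 := by ext; simp
      rw [this]
      simp
    · have h1 := h ((‖v‖⁻¹ : ℝ) • v) (by rw [norm_smul]; simp [hv])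
      have h2 : (fun y => fderiv ℝ g y v) = ‖v‖ • fun y => fderiv ℝ g y ((‖v‖⁻¹ : ℝ) • v) := by
        ext y
        simp [smul_smul, hv]
      have hsm : ContDiff ℝ ∞ (fun y => fderiv ℝ g y ((‖v‖⁻¹ : ℝ) • v)) :=
        (hg.fderiv_right (m := ∞) (by simp)).clm_apply contDiff_const
      rw [h2, iteratedFDeriv_const_smul_apply (hsm.of_le (by exact_mod_cast le_top)).contDiffAt]
      calc _ = ‖v‖ * ‖iteratedFDeriv ℝ n (fun y => fderiv ℝ g y ((‖v‖⁻¹ : ℝ) • v)) x m‖ := by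
              simp [norm_smul]
        _ ≤ ‖v‖ * (c * ∏ i, ‖m i‖) := by
              gcongr
              exact (ContinuousMultilinearMap.le_opNorm _ _).trans (by gcongr)
        _ = _ := by ring
  refine ContinuousMultilinearMap.opNorm_le_bound hc fun m => ?_
  rw [key, Fin.prod_univ_castSucc]
  refine (hunit _ _).trans (le_of_eq ?_)
  simp only [Fin.init]
  ring

theorem fderiv_schwartz_apply_eq (f : 𝓢(Space d, ℂ)) (v : Space d) :
    (fun y => fderiv ℝ f y v) = ⇑(∂_{v} f : 𝓢(Space d, ℂ)) := by
  ext y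
  exact (SchwartzMap.lineDerivOp_apply_eq_fderiv v f y).symm

theorem norm_iteratedFDeriv_lineDerivOp_le (f : 𝓢(Space d, ℂ)) {v : Space d} (hv : ‖v‖ ≤ 1)
    (n : ℕ) (x : Space d) :
    ‖iteratedFDeriv ℝ n (∂_{v} f : 𝓢(Space d, ℂ)) x‖ ≤ ‖iteratedFDeriv ℝ (n + 1) f x‖ := by
  rw [← fderiv_schwartz_apply_eq, ← norm_iteratedFDeriv_fderiv]
  refine (norm_iteratedFDeriv_clm_apply_const (N := ∞)
    (((f.smooth ⊤).fderiv_right (m := ∞) (by simp)).contDiffAt)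
    (by exact_mod_cast le_top)).trans ?_
  exact mul_le_of_le_one_left (norm_nonneg _) hv

theorem schwartzNorm_lineDerivOp_le (j : ℕ) (f : 𝓢(Space d, ℂ)) {v : Space d} (hv : ‖v‖ ≤ 1) :
    schwartzNorm j (∂_{v} f) ≤ schwartzNorm (j + 1) f :=
  schwartzNorm_le (schwartzNorm_nonneg _ _) fun k hk n hn x =>
    (mul_le_mul_of_nonneg_left (norm_iteratedFDeriv_lineDerivOp_le f hv n x)
      (by positivity)).trans (pow_mul_le_schwartzNorm (by omega) (by omega) f x)

theorem hasTemperateGrowth_coord (v : Space d) :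
    Function.HasTemperateGrowth (fun y : Space d => ((inner ℝ y v : ℝ) : ℂ)) :=
  (Complex.ofRealCLM.hasTemperateGrowth).comp (Function.hasTemperateGrowth_inner_left v)

/-- Multiplication by the linear function `y ↦ ⟨y, v⟩`. -/
def coordMul (v : Space d) : 𝓢(Space d, ℂ) →L[ℂ] 𝓢(Space d, ℂ) :=
  SchwartzMap.smulLeftCLM ℂ (fun y : Space d => ((inner ℝ y v : ℝ) : ℂ))

theorem coordMul_apply (v : Space d) (f : 𝓢(Space d, ℂ)) (y : Space d) :
    coordMul v f y = ((inner ℝ y v : ℝ) : ℂ) * f y := by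
  rw [coordMul, SchwartzMap.smulLeftCLM_apply_apply (hasTemperateGrowth_coord v)]
  simp

theorem lineDerivOp_coordMul (v w : Space d) (f : 𝓢(Space d, ℂ)) :
    ∂_{w} (coordMul v f) = ((inner ℝ w v : ℝ) : ℂ) • f + coordMul v (∂_{w} f) := by
  ext y
  have h1 : HasFDerivAt (fun y : Space d => ((inner ℝ y v : ℝ) : ℂ))
      (Complex.ofRealCLM.comp (innerSL ℝ v)) y := by
    have : (fun y : Space d => ((inner ℝ y v : ℝ) : ℂ)) =
        Complex.ofRealCLM.comp (innerSL ℝ v) := by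
      ext y; simp [real_inner_comm]
    rw [this]
    exact ContinuousLinearMap.hasFDerivAt _
  have h2 : ⇑(coordMul v f) = fun y => ((inner ℝ y v : ℝ) : ℂ) * f y :=
    funext (coordMul_apply v f)
  rw [SchwartzMap.lineDerivOp_apply_eq_fderiv, h2, (h1.fun_mul (f.hasFDerivAt y)).fderiv]
  simp [coordMul_apply, SchwartzMap.lineDerivOp_apply_eq_fderiv, real_inner_comm]
  ring

theorem norm_iteratedFDeriv_coe_add_le (f g : 𝓢(Space d, ℂ)) (n : ℕ) (x : Space d) :
    ‖iteratedFDeriv ℝ n (f + g : 𝓢(Space d, ℂ)) x‖ ≤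
      ‖iteratedFDeriv ℝ n f x‖ + ‖iteratedFDeriv ℝ n g x‖ := by
  have : ⇑(f + g) = ⇑f + ⇑g := rfl
  rw [this, iteratedFDeriv_add_apply (f.smooth n).contDiffAt (g.smooth n).contDiffAt]
  exact norm_add_le _ _

theorem norm_iteratedFDeriv_coe_smul (c : ℂ) (f : 𝓢(Space d, ℂ)) (n : ℕ) (x : Space d) :
    ‖iteratedFDeriv ℝ n (c • f : 𝓢(Space d, ℂ)) x‖ = ‖c‖ * ‖iteratedFDeriv ℝ n f x‖ := by
  have : ⇑(c • f) = c • ⇑f := rfl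
  rw [this, iteratedFDeriv_const_smul_apply (f.smooth n).contDiffAt, norm_smul]

theorem abs_inner_le_of_norm_le_one (x : Space d) {v : Space d} (hv : ‖v‖ ≤ 1) :
    |inner ℝ x v| ≤ ‖x‖ :=
  (abs_real_inner_le_norm x v).trans (mul_le_of_le_one_right (norm_nonneg _) hv)

/-- Induction on the order of differentiation through the commutator `[∂_w, ⟨·, v⟩] = ⟨w, v⟩`.
Uniformity in `v` matters because later `v` is chosen depending on the point. -/
theorem exists_schwartzNorm_coordMul_le (j : ℕ) : ∃ (C : ℝ) (j' : ℕ), 0 ≤ C ∧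
    ∀ (v : Space d), ‖v‖ ≤ 1 → ∀ f : 𝓢(Space d, ℂ),
      schwartzNorm j (coordMul v f) ≤ C * schwartzNorm j' f := by
  have key : ∀ n k : ℕ, ∃ (C : ℝ) (j : ℕ), ∀ (v : Space d), ‖v‖ ≤ 1 → ∀ (f : 𝓢(Space d, ℂ)) x,
      ‖x‖ ^ k * ‖iteratedFDeriv ℝ n (coordMul v f) x‖ ≤ C * schwartzNorm j f := by
    intro n k
    induction n with
    | zero =>
      refine ⟨1, k + 1, fun v hv f x => ?_⟩
      have h1 := pow_mul_le_schwartzNorm (le_refl (k + 1)) (Nat.zero_le _) f x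
      simp only [norm_iteratedFDeriv_zero, coordMul_apply, norm_mul, Complex.norm_real,
        Real.norm_eq_abs, one_mul] at h1 ⊢
      calc _ ≤ ‖x‖ ^ k * (‖x‖ * ‖f x‖) := by gcongr; exact abs_inner_le_of_norm_le_one x hv
        _ = ‖x‖ ^ (k + 1) * ‖f x‖ := by ring
        _ ≤ _ := h1
    | succ n ih =>
      obtain ⟨C, j, h⟩ := ih
      refine ⟨1 + |C|, n + k + j + 1, fun v hv f x => ?_⟩
      have hN := schwartzNorm_nonneg (n + k + j + 1) f
      -- A nonzero weight can be divided to the right, so that `norm_iteratedFDeriv_succ_le` applies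
      -- to the bare derivative.
      rcases eq_or_ne (‖x‖ ^ k) 0 with h0 | h0
      · rw [h0, zero_mul]; positivity
      have h0' : 0 < ‖x‖ ^ k := lt_of_le_of_ne (by positivity) h0.symm
      rw [← le_div_iff₀' h0']
      refine norm_iteratedFDeriv_succ_le (SchwartzMap.smooth _ ⊤) n x fun w hw => ?_
      rw [le_div_iff₀' h0', fderiv_schwartz_apply_eq, lineDerivOp_coordMul]
      calc _ ≤ ‖x‖ ^ k * (‖iteratedFDeriv ℝ n f x‖ +
            ‖iteratedFDeriv ℝ n (coordMul v (∂_{w} f)) x‖) := by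
              gcongr
              refine (norm_iteratedFDeriv_coe_add_le _ _ n x).trans ?_
              gcongr
              rw [norm_iteratedFDeriv_coe_smul, Complex.norm_real, Real.norm_eq_abs]
              exact mul_le_of_le_one_left (norm_nonneg _)
                ((abs_inner_le_of_norm_le_one w hv).trans hw)
        _ ≤ schwartzNorm (n + k + j + 1) f + |C| * schwartzNorm (n + k + j + 1) f := by
              rw [mul_add]
              refine add_le_add (pow_mul_le_schwartzNorm (by omega) (by omega) f x) ?_
              refine (h v hv _ x).trans ?_
              have h1 := (schwartzNorm_lineDerivOp_le j f hw).trans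
                (schwartzNorm_mono (show j + 1 ≤ n + k + j + 1 by omega) f)
              have h2 := schwartzNorm_nonneg j (∂_{w} f)
              gcongr
              exact le_abs_self C
        _ = _ := by ring
  obtain ⟨C, K, j', hC, h⟩ := exists_schwartzNorm_le (ι := {v : Space d // ‖v‖ ≤ 1})
    (w := fun _ => 1) (T := fun v f => coordMul v.1 f) (fun _ => le_rfl) (fun k n => by
      obtain ⟨C, j, h⟩ := key n k
      exact ⟨C, 0, j, fun i f x => by simpa using h i.1 i.2 f x⟩) j
  exact ⟨C, j', hC, fun v hv f => by simpa using h ⟨v, hv⟩ f⟩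

/-! ### Phase space shifts -/

/-- Each derivative that falls on the modulation costs one power of `|ξ|`; together with the
translation of the weight, this is the source of the polynomial growth in `z`. -/
theorem lineDerivOp_phaseShift (z : PhaseSpace d) (v : Space d) (f : 𝓢(Space d, ℂ)) :
    ∂_{v} (phaseShift z f) =
      (Complex.I * (inner ℝ v z.2 : ℝ)) • phaseShift z f + phaseShift z (∂_{v} f) := by
  ext y
  have h1 : HasFDerivAt (fun y : Space d => ((inner ℝ y z.2 : ℝ) : ℂ))
      (Complex.ofRealCLM.comp (innerSL ℝ z.2)) y := by
    have : (fun y : Space d => ((inner ℝ y z.2 : ℝ) : ℂ)) =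
        Complex.ofRealCLM.comp (innerSL ℝ z.2) := by
      ext y; simp [real_inner_comm]
    rw [this]
    exact ContinuousLinearMap.hasFDerivAt _
  have h2 : ⇑(phaseShift z f) =
      fun y => Complex.exp ((inner ℝ y z.2 : ℝ) * Complex.I) * f (y - z.1) :=
    funext (phaseShift_apply z f)
  have h3 : HasFDerivAt (fun y => f (y - z.1)) (fderiv ℝ f (y - z.1)) y := by
    rw [hasFDerivAt_comp_sub]
    exact f.hasFDerivAt _
  rw [SchwartzMap.lineDerivOp_apply_eq_fderiv, h2, ((h1.mul_const Complex.I).cexp.fun_mul h3).fderiv]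
  simp [phaseShift_apply, SchwartzMap.lineDerivOp_apply_eq_fderiv, real_inner_comm]
  ring

theorem phaseShift_add (z : PhaseSpace d) (f g : 𝓢(Space d, ℂ)) :
    phaseShift z (f + g) = phaseShift z f + phaseShift z g := by
  ext y; simp [phaseShift_apply, mul_add]

theorem norm_phaseShift_apply (z : PhaseSpace d) (f : 𝓢(Space d, ℂ)) (y : Space d) :
    ‖phaseShift z f y‖ = ‖f (y - z.1)‖ := by
  rw [phaseShift_apply, norm_mul, Complex.norm_exp_ofReal_mul_I, one_mul]

/-- Phase space shifts are bounded in every Schwartz norm, with polynomial growth in `z`. -/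
theorem exists_schwartzNorm_phaseShift_le (j : ℕ) : ∃ (C : ℝ) (K j' : ℕ), 0 ≤ C ∧
    ∀ (z : PhaseSpace d) (f : 𝓢(Space d, ℂ)),
      schwartzNorm j (phaseShift z f) ≤ C * (1 + ‖z‖) ^ K * schwartzNorm j' f := by
  refine exists_schwartzNorm_le (w := fun z : PhaseSpace d => 1 + ‖z‖)
    (fun z => by simp) (fun k n => ?_) j
  induction n with
  | zero =>
    refine ⟨2 ^ k, k, k, fun z f y => ?_⟩
    have h1 := one_add_pow_mul_norm_le (le_refl k) f (y - z.1)
    have h2 : ‖y‖ ≤ (1 + ‖z‖) * (1 + ‖y - z.1‖) := by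
      have h3 : ‖y‖ ≤ ‖z.1‖ + ‖y - z.1‖ := by simpa using norm_add_le z.1 (y - z.1)
      nlinarith [norm_fst_le z, norm_nonneg z, norm_nonneg (y - z.1)]
    simp only [norm_iteratedFDeriv_zero, norm_phaseShift_apply]
    calc _ ≤ ((1 + ‖z‖) * (1 + ‖y - z.1‖)) ^ k * ‖f (y - z.1)‖ := by gcongr
      _ = (1 + ‖z‖) ^ k * ((1 + ‖y - z.1‖) ^ k * ‖f (y - z.1)‖) := by rw [mul_pow]; ring
      _ ≤ (1 + ‖z‖) ^ k * (2 ^ k * schwartzNorm k f) := by gcongr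
      _ = _ := by ring
  | succ n ih =>
    obtain ⟨C, K, j, h⟩ := ih
    refine ⟨2 * |C|, K + 1, j + 1, fun z f x => ?_⟩
    have hN := schwartzNorm_nonneg (j + 1) f
    rcases eq_or_ne (‖x‖ ^ k) 0 with h0 | h0
    · rw [h0, zero_mul]; positivity
    have h0' : 0 < ‖x‖ ^ k := lt_of_le_of_ne (by positivity) h0.symm
    rw [← le_div_iff₀' h0']
    refine norm_iteratedFDeriv_succ_le (SchwartzMap.smooth _ ⊤) n x fun v hv => ?_
    rw [le_div_iff₀' h0', fderiv_schwartz_apply_eq, lineDerivOp_phaseShift]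
    have hC : C ≤ |C| := le_abs_self C
    have hz : 0 ≤ ‖z‖ := norm_nonneg z
    have e1 : ‖x‖ ^ k * ‖iteratedFDeriv ℝ n (phaseShift z f) x‖ ≤
        |C| * (1 + ‖z‖) ^ K * schwartzNorm (j + 1) f := by
      refine (h z f x).trans ?_
      have := schwartzNorm_mono (Nat.le_succ j) f
      have h2 := schwartzNorm_nonneg j f
      gcongr
    have e2 : ‖x‖ ^ k * ‖iteratedFDeriv ℝ n (phaseShift z (∂_{v} f)) x‖ ≤
        |C| * (1 + ‖z‖) ^ K * schwartzNorm (j + 1) f := by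
      refine (h z _ x).trans ?_
      have := schwartzNorm_lineDerivOp_le j f hv
      have h2 := schwartzNorm_nonneg j (∂_{v} f)
      gcongr
    calc _ ≤ ‖x‖ ^ k * (‖z‖ * ‖iteratedFDeriv ℝ n (phaseShift z f) x‖ +
            ‖iteratedFDeriv ℝ n (phaseShift z (∂_{v} f)) x‖) := by
            gcongr
            refine (norm_iteratedFDeriv_coe_add_le _ _ n x).trans ?_
            gcongr
            rw [norm_iteratedFDeriv_coe_smul, norm_mul, Complex.norm_I, one_mul,
              Complex.norm_real, Real.norm_eq_abs]
            gcongr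
            rw [real_inner_comm]
            exact (abs_inner_le_of_norm_le_one _ hv).trans (norm_snd_le z)
      _ = ‖z‖ * (‖x‖ ^ k * ‖iteratedFDeriv ℝ n (phaseShift z f) x‖) +
            ‖x‖ ^ k * ‖iteratedFDeriv ℝ n (phaseShift z (∂_{v} f)) x‖ := by ring
      _ ≤ ‖z‖ * (|C| * (1 + ‖z‖) ^ K * schwartzNorm (j + 1) f) +
            |C| * (1 + ‖z‖) ^ K * schwartzNorm (j + 1) f := by gcongr
      _ = |C| * (1 + ‖z‖) ^ (K + 1) * schwartzNorm (j + 1) f := by ring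
      _ ≤ _ := by
            have : 0 ≤ |C| * (1 + ‖z‖) ^ (K + 1) * schwartzNorm (j + 1) f := by positivity
            linarith

/-! ### Weighted integrals of Schwartz functions -/

theorem integrable_one_add_norm_pow_inv :
    Integrable (fun y : Space d => ((1 + ‖y‖) ^ (d + 1))⁻¹) := by
  have := integrable_one_add_norm (E := Space d) (μ := volume) (r := (d + 1 : ℕ)) (by simp)
  refine this.congr (Filter.Eventually.of_forall fun y => ?_)
  simp only
  rw [Real.rpow_neg (by positivity), Real.rpow_natCast]

/-- The spare `d + 1` powers of decay make the right side integrable over `ℝ^d`. -/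
theorem norm_le_schwartzNorm_mul (k : ℕ) (f : 𝓢(Space d, ℂ)) (y : Space d) :
    (1 + ‖y‖) ^ k * ‖f y‖ ≤
      2 ^ (k + d + 1) * schwartzNorm (k + d + 1) f * ((1 + ‖y‖) ^ (d + 1))⁻¹ := by
  rw [← div_eq_mul_inv, le_div_iff₀ (by positivity)]
  refine le_trans (le_of_eq ?_) (one_add_pow_mul_norm_le (le_refl (k + d + 1)) f y)
  ring

theorem integrable_one_add_norm_pow_mul (k : ℕ) (f : 𝓢(Space d, ℂ)) :
    Integrable (fun y : Space d => (1 + ‖y‖) ^ k * ‖f y‖) := by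
  refine (integrable_one_add_norm_pow_inv.const_mul
    (2 ^ (k + d + 1) * schwartzNorm (k + d + 1) f)).mono'
    (Continuous.aestronglyMeasurable (by have := f.continuous; fun_prop))
    (Filter.Eventually.of_forall fun y => ?_)
  rw [Real.norm_of_nonneg (by positivity)]
  exact norm_le_schwartzNorm_mul k f y

theorem exists_integral_one_add_norm_pow_mul_le (k : ℕ) : ∃ (C : ℝ) (j : ℕ), 0 ≤ C ∧
    ∀ f : 𝓢(Space d, ℂ), ∫ y, (1 + ‖y‖) ^ k * ‖f y‖ ≤ C * schwartzNorm j f := by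
  refine ⟨2 ^ (k + d + 1) * ∫ y : Space d, ((1 + ‖y‖) ^ (d + 1))⁻¹, k + d + 1,
    mul_nonneg (by positivity) (integral_nonneg fun y => by positivity), fun f => ?_⟩
  calc _ ≤ ∫ y : Space d, 2 ^ (k + d + 1) * schwartzNorm (k + d + 1) f *
          ((1 + ‖y‖) ^ (d + 1))⁻¹ :=
        integral_mono (integrable_one_add_norm_pow_mul k f)
          (integrable_one_add_norm_pow_inv.const_mul _) (norm_le_schwartzNorm_mul k f)
    _ = _ := by rw [integral_const_mul]; ring

/-! ### The short-time Fourier transform of a Schwartz function -/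

/-- The `L²` inner product `(f, Π(z) h)`. -/
def innerPhaseShift (f h : 𝓢(Space d, ℂ)) (z : PhaseSpace d) : ℂ :=
  ∫ y, conj (phaseShift z h y) * f y

theorem pairing_toTemperedDistributionCLM (f h : 𝓢(Space d, ℂ)) (z : PhaseSpace d) :
    pairing (SchwartzMap.toTemperedDistributionCLM (Space d) ℂ volume f) (phaseShift z h) =
      innerPhaseShift f h z := by
  simp [pairing, innerPhaseShift, SchwartzMap.toTemperedDistributionCLM_apply_apply,
    conjSchwartz_apply]

theorem integrable_innerPhaseShift (f h : 𝓢(Space d, ℂ)) (z : PhaseSpace d) :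
    Integrable (fun y => conj (phaseShift z h y) * f y) := by
  obtain ⟨C, hC⟩ := (conjSchwartz (phaseShift z h)).decay 0 0
  refine f.integrable.bdd_mul (c := C)
    (conjSchwartz (phaseShift z h)).continuous.aestronglyMeasurable
    (Filter.Eventually.of_forall fun y => ?_)
  simpa [conjSchwartz_apply] using hC.2 y

theorem lineDerivOp_conjSchwartz (v : Space d) (g : 𝓢(Space d, ℂ)) :
    ∂_{v} (conjSchwartz g) = conjSchwartz (∂_{v} g) := by
  ext y
  have : HasFDerivAt (conjSchwartz g) ((Complex.conjCLE : ℂ →L[ℝ] ℂ).comp (fderiv ℝ g y)) y :=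
    (Complex.conjCLE : ℂ →L[ℝ] ℂ).hasFDerivAt.comp y (g.hasFDerivAt y)
  rw [SchwartzMap.lineDerivOp_apply_eq_fderiv, this.fderiv, conjSchwartz_apply,
    SchwartzMap.lineDerivOp_apply_eq_fderiv]
  simp

/-- Integration by parts: the frequency factor is a derivative of the exponential, moved onto `f`
and onto the window. -/
theorem freq_mul_innerPhaseShift (f h : 𝓢(Space d, ℂ)) (z : PhaseSpace d) (v : Space d) :
    Complex.I * (inner ℝ v z.2 : ℝ) * innerPhaseShift f h z =
      innerPhaseShift (∂_{v} f) h z + innerPhaseShift f (∂_{v} h) z := by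
  have h1 := SchwartzMap.integral_mul_lineDerivOp_right_eq_neg_left (μ := volume)
    (conjSchwartz (phaseShift z h)) f v
  have h2 : ∀ y, (∂_{v} (conjSchwartz (phaseShift z h))) y * f y =
      -(Complex.I * (inner ℝ v z.2 : ℝ)) * (conj (phaseShift z h y) * f y) +
        conj (phaseShift z (∂_{v} h) y) * f y := by
    intro y
    rw [lineDerivOp_conjSchwartz, lineDerivOp_phaseShift, conjSchwartz_apply]
    simp
    ring
  simp_rw [h2] at h1
  rw [integral_add ((integrable_innerPhaseShift f h z).const_mul _)
    (integrable_innerPhaseShift f _ z), integral_const_mul] at h1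
  have h3 : innerPhaseShift (∂_{v} f) h z =
      ∫ y, conjSchwartz (phaseShift z h) y * (∂_{v} f) y := rfl
  rw [h3, h1]
  simp only [innerPhaseShift]
  ring

/-- Under the integral, `⟨x, v⟩ = ⟨y, v⟩ - ⟨y - x, v⟩`; the first part multiplies `f` and the second
the window. -/
theorem pos_mul_innerPhaseShift (f h : 𝓢(Space d, ℂ)) (z : PhaseSpace d) (v : Space d) :
    ((inner ℝ z.1 v : ℝ) : ℂ) * innerPhaseShift f h z =
      innerPhaseShift (coordMul v f) h z - innerPhaseShift f (coordMul v h) z := by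
  simp only [innerPhaseShift]
  rw [← integral_const_mul, ← integral_sub (integrable_innerPhaseShift _ h z)
    (integrable_innerPhaseShift f _ z)]
  congr 1
  ext y
  simp only [phaseShift_apply, coordMul_apply, inner_sub_left, map_mul, Complex.conj_ofReal]
  push_cast
  ring

/-- This turns the directional identities into gains of a full factor `‖x‖`, without coordinates. -/
theorem exists_norm_le_one_inner_eq (x : Space d) : ∃ v : Space d, ‖v‖ ≤ 1 ∧ inner ℝ x v = ‖x‖ := by
  rcases eq_or_ne x 0 with rfl | hx
  · exact ⟨0, by simp, by simp⟩
  · refine ⟨(‖x‖⁻¹ : ℝ) • x, by rw [norm_smul]; simp [hx], ?_⟩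
    rw [inner_smul_right, real_inner_self_eq_norm_sq]
    field_simp

/-- The short-time Fourier transform of a Schwartz function decays rapidly, uniformly for the
window in bounded sets. -/
theorem exists_norm_innerPhaseShift_le (k : ℕ) : ∃ (C : ℝ) (j : ℕ), 0 ≤ C ∧
    ∀ (f h : 𝓢(Space d, ℂ)) (z : PhaseSpace d),
      (1 + ‖z.1‖ + ‖z.2‖) ^ k * ‖innerPhaseShift f h z‖ ≤
        C * (schwartzNorm j f * schwartzNorm j h) := by
  induction k with
  | zero =>
    obtain ⟨C, j, hC, hint⟩ := exists_integral_one_add_norm_pow_mul_le (d := d) 0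
    refine ⟨C, j, hC, fun f h z => ?_⟩
    have hh : ∀ y, ‖h y‖ ≤ schwartzNorm j h := fun y => by
      simpa using pow_mul_le_schwartzNorm (Nat.zero_le j) (Nat.zero_le j) h y
    have hN := schwartzNorm_nonneg j h
    rw [pow_zero, one_mul]
    calc _ ≤ ∫ y, schwartzNorm j h * ((1 + ‖y‖) ^ 0 * ‖f y‖) := by
          refine norm_integral_le_of_norm_le ((integrable_one_add_norm_pow_mul 0 f).const_mul _)
            (Filter.Eventually.of_forall fun y => ?_)
          rw [norm_mul, RCLike.norm_conj, norm_phaseShift_apply, pow_zero, one_mul]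
          gcongr
          exact hh _
      _ ≤ schwartzNorm j h * (C * schwartzNorm j f) := by
          rw [integral_const_mul]
          gcongr
          exact hint f
      _ = _ := by ring
  | succ k ih =>
    obtain ⟨C, j, hC, ih⟩ := ih
    obtain ⟨D, j', hD, hX⟩ := exists_schwartzNorm_coordMul_le (d := d) j
    -- The factor `1 + |x| + |ξ|` yields one unchanged term, two with a coordinate multiplication
    -- (cost `D` each), and two with a derivative.
    refine ⟨C * (1 + 2 * D + 2), j + 1 + j', by positivity, fun f h z => ?_⟩
    obtain ⟨v, hv, hvx⟩ := exists_norm_le_one_inner_eq z.1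
    obtain ⟨w, hw, hwx⟩ := exists_norm_le_one_inner_eq z.2
    set J := j + 1 + j'
    have hm : ∀ g : 𝓢(Space d, ℂ), schwartzNorm j g ≤ schwartzNorm J g :=
      schwartzNorm_mono (by omega)
    have hdm : ∀ g : 𝓢(Space d, ℂ), schwartzNorm j (∂_{w} g) ≤ schwartzNorm J g := fun g =>
      (schwartzNorm_lineDerivOp_le j g hw).trans (schwartzNorm_mono (by omega) g)
    have hXm : ∀ g : 𝓢(Space d, ℂ), schwartzNorm j (coordMul v g) ≤ D * schwartzNorm J g :=
      fun g => (hX v hv g).trans (by gcongr; exact schwartzNorm_mono (by omega) g)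
    have hN := schwartzNorm_nonneg (d := d)
    have e1 : ‖z.1‖ * ‖innerPhaseShift f h z‖ ≤ ‖innerPhaseShift (coordMul v f) h z‖ +
        ‖innerPhaseShift f (coordMul v h) z‖ := by
      have := pos_mul_innerPhaseShift f h z v
      rw [hvx] at this
      have h2 := congrArg norm this
      rw [norm_mul, Complex.norm_real, norm_norm] at h2
      rw [h2]
      exact norm_sub_le _ _
    have e2 : ‖z.2‖ * ‖innerPhaseShift f h z‖ ≤ ‖innerPhaseShift (∂_{w} f) h z‖ +
        ‖innerPhaseShift f (∂_{w} h) z‖ := by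
      have := freq_mul_innerPhaseShift f h z w
      rw [real_inner_comm, hwx] at this
      have h2 := congrArg norm this
      rw [norm_mul, norm_mul, Complex.norm_real, norm_norm, Complex.norm_I, one_mul] at h2
      rw [h2]
      exact norm_add_le _ _
    have mulle : ∀ {a b a' b' : ℝ}, 0 ≤ a → 0 ≤ b → a ≤ a' → b ≤ b' →
        C * (a * b) ≤ C * (a' * b') := fun ha hb h1 h2 =>
      mul_le_mul_of_nonneg_left (mul_le_mul h1 h2 hb (ha.trans h1)) hC
    calc _ = (1 + ‖z.1‖ + ‖z.2‖) ^ k * (‖innerPhaseShift f h z‖ +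
          ‖z.1‖ * ‖innerPhaseShift f h z‖ + ‖z.2‖ * ‖innerPhaseShift f h z‖) := by ring
      _ ≤ (1 + ‖z.1‖ + ‖z.2‖) ^ k * (‖innerPhaseShift f h z‖ +
          (‖innerPhaseShift (coordMul v f) h z‖ + ‖innerPhaseShift f (coordMul v h) z‖) +
          (‖innerPhaseShift (∂_{w} f) h z‖ + ‖innerPhaseShift f (∂_{w} h) z‖)) := by gcongr
      _ = (1 + ‖z.1‖ + ‖z.2‖) ^ k * ‖innerPhaseShift f h z‖ +
          ((1 + ‖z.1‖ + ‖z.2‖) ^ k * ‖innerPhaseShift (coordMul v f) h z‖ +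
            (1 + ‖z.1‖ + ‖z.2‖) ^ k * ‖innerPhaseShift f (coordMul v h) z‖) +
          ((1 + ‖z.1‖ + ‖z.2‖) ^ k * ‖innerPhaseShift (∂_{w} f) h z‖ +
            (1 + ‖z.1‖ + ‖z.2‖) ^ k * ‖innerPhaseShift f (∂_{w} h) z‖) := by ring
      _ ≤ C * (schwartzNorm J f * schwartzNorm J h) +
          (C * ((D * schwartzNorm J f) * schwartzNorm J h) +
            C * (schwartzNorm J f * (D * schwartzNorm J h))) +
          (C * (schwartzNorm J f * schwartzNorm J h) +
            C * (schwartzNorm J f * schwartzNorm J h)) := by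
          refine add_le_add (add_le_add ?_ (add_le_add ?_ ?_)) (add_le_add ?_ ?_)
          · exact (ih f h z).trans (mulle (hN _ _) (hN _ _) (hm f) (hm h))
          · exact (ih _ h z).trans (mulle (hN _ _) (hN _ _) (hXm f) (hm h))
          · exact (ih f _ z).trans
              (mulle (hN _ _) (hN _ _) (hm f) (hXm h))
          · exact (ih _ h z).trans (mulle (hN _ _) (hN _ _) (hdm f) (hm h))
          · exact (ih f _ z).trans (mulle (hN _ _) (hN _ _) (hm f) (hdm h))
      _ = _ := by ring

/-! ### Symbols of polynomial growth -/

/-- `q` is smooth, and all its derivatives grow at most like `(1 + |w|)^M`, with the constants `B`.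
-/
def SymbolBound (M : ℕ) (B : ℕ → ℝ) (q : PhaseSpace d → ℂ) : Prop :=
  ContDiff ℝ ∞ q ∧ ∀ (n : ℕ) (w : PhaseSpace d), ‖iteratedFDeriv ℝ n q w‖ ≤ B n * (1 + ‖w‖) ^ M

/-- The derivative of a symbol in a fixed direction. -/
def symbolDeriv (v : PhaseSpace d) (q : PhaseSpace d → ℂ) : PhaseSpace d → ℂ :=
  fun w => fderiv ℝ q w v

namespace SymbolBound

variable {M : ℕ} {B : ℕ → ℝ} {q : PhaseSpace d → ℂ}

theorem nonneg (hq : SymbolBound M B q) (n : ℕ) : 0 ≤ B n := by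
  simpa using (norm_nonneg _).trans (hq.2 n 0)

/-- The growth exponent `M` is unchanged and the constants are merely shifted. The inductions below
therefore generalize over `B` with `M` fixed. -/
theorem directional (hq : SymbolBound M B q) {v : PhaseSpace d} (hv : ‖v‖ ≤ 1) :
    SymbolBound M (fun n => B (n + 1)) (symbolDeriv v q) := by
  have h1 : ContDiff ℝ ∞ (fderiv ℝ q) := hq.1.fderiv_right (m := ∞) (by simp)
  refine ⟨h1.clm_apply contDiff_const, fun n w => ?_⟩
  refine ((norm_iteratedFDeriv_clm_apply_const (N := ∞) h1.contDiffAt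
    (by exact_mod_cast le_top)).trans ?_).trans (hq.2 (n + 1) w)
  rw [norm_iteratedFDeriv_fderiv]
  exact mul_le_of_le_one_left (norm_nonneg _) hv

theorem norm_le (hq : SymbolBound M B q) (w : PhaseSpace d) : ‖q w‖ ≤ B 0 * (1 + ‖w‖) ^ M := by
  simpa using hq.2 0 w

theorem norm_fderiv_le (hq : SymbolBound M B q) (w : PhaseSpace d) :
    ‖fderiv ℝ q w‖ ≤ B 1 * (1 + ‖w‖) ^ M := by
  simpa [norm_iteratedFDeriv_one] using hq.2 1 w

theorem differentiable (hq : SymbolBound M B q) : Differentiable ℝ q :=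
  hq.1.differentiable (by simp)

end SymbolBound

/-! ### The inner integral of the Weyl quantization -/

/-- The midpoint `((x + y) / 2, ξ)` at which the Weyl quantization evaluates the symbol. -/
def midpointArg (z : PhaseSpace d) (y : Space d) : PhaseSpace d := ((2⁻¹ : ℝ) • (z.1 + y), z.2)

/-- The oscillating factor of the Weyl quantization. -/
def weylPhase (z : PhaseSpace d) (y : Space d) : ℂ :=
  Complex.exp ((inner ℝ (z.1 - y) z.2 : ℝ) * Complex.I)

/-- The inner integral of the Weyl quantization, as a function of `z = (x, ξ)`. -/
def weylInner (q : PhaseSpace d → ℂ) (f : 𝓢(Space d, ℂ)) (z : PhaseSpace d) : ℂ :=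
  ∫ y, weylPhase z y * q (midpointArg z y) * f y

theorem norm_weylPhase (z : PhaseSpace d) (y : Space d) : ‖weylPhase z y‖ = 1 :=
  Complex.norm_exp_ofReal_mul_I _

/-- A product bound separates the variables: powers of `1 + ‖y‖` are absorbed by the Schwartz
function, the others leave the integral. -/
theorem one_add_norm_midpointArg_le (z : PhaseSpace d) (y : Space d) :
    1 + ‖midpointArg z y‖ ≤ (1 + ‖z.1‖) * (1 + ‖z.2‖) * (1 + ‖y‖) := by
  have h1 : ‖midpointArg z y‖ ≤ ‖z.1‖ + ‖y‖ + ‖z.2‖ := by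
    refine max_le ?_ (by simp only [midpointArg]; linarith [norm_nonneg z.1, norm_nonneg y])
    simp only [midpointArg]
    rw [norm_smul]
    have := norm_add_le z.1 y
    norm_num
    linarith [norm_nonneg z.1, norm_nonneg y, norm_nonneg z.2, norm_nonneg (z.1 + y)]
  have a := norm_nonneg z.1
  have b := norm_nonneg z.2
  have c := norm_nonneg y
  calc _ ≤ 1 + (‖z.1‖ + ‖y‖ + ‖z.2‖) := by linarith
    _ ≤ 1 + (‖z.1‖ + ‖y‖ + ‖z.2‖) + (‖z.1‖ * ‖z.2‖ + ‖z.1‖ * ‖y‖ + ‖z.2‖ * ‖y‖ +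
          ‖z.1‖ * ‖z.2‖ * ‖y‖) := le_add_of_nonneg_right (by positivity)
    _ = _ := by ring

theorem one_add_norm_midpointArg_pow_le (M : ℕ) (z : PhaseSpace d) (y : Space d) :
    (1 + ‖midpointArg z y‖) ^ M ≤ (1 + ‖z.1‖) ^ M * (1 + ‖z.2‖) ^ M * (1 + ‖y‖) ^ M := by
  rw [← mul_pow, ← mul_pow]
  exact pow_le_pow_left₀ (by positivity) (one_add_norm_midpointArg_le z y) M

theorem contDiff_midpointArg : ContDiff ℝ ∞ fun p : PhaseSpace d × Space d =>
    midpointArg p.1 p.2 := by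
  unfold midpointArg
  fun_prop

theorem contDiff_weylPhase : ContDiff ℝ ∞ fun p : PhaseSpace d × Space d =>
    weylPhase p.1 p.2 := by
  unfold weylPhase
  have h : ContDiff ℝ ∞ fun p : PhaseSpace d × Space d => inner ℝ (p.1.1 - p.2) p.1.2 :=
    ContDiff.inner ℝ (by fun_prop) (by fun_prop)
  exact ((Complex.ofRealCLM.contDiff.comp h).mul contDiff_const).cexp

section Inner

variable {M : ℕ} {B : ℕ → ℝ} {q : PhaseSpace d → ℂ}

theorem SymbolBound.contDiff_kernel (hq : SymbolBound M B q) :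
    ContDiff ℝ ∞ fun p : PhaseSpace d × Space d => weylPhase p.1 p.2 * q (midpointArg p.1 p.2) :=
  contDiff_weylPhase.mul (hq.1.comp contDiff_midpointArg)

theorem SymbolBound.continuous_integrand (hq : SymbolBound M B q) (f : 𝓢(Space d, ℂ)) :
    Continuous fun p : PhaseSpace d × Space d =>
      weylPhase p.1 p.2 * q (midpointArg p.1 p.2) * f p.2 :=
  hq.contDiff_kernel.continuous.mul (f.continuous.comp continuous_snd)

theorem SymbolBound.norm_integrand_le (hq : SymbolBound M B q) (f : 𝓢(Space d, ℂ))
    (z : PhaseSpace d) (y : Space d) :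
    ‖weylPhase z y * q (midpointArg z y) * f y‖ ≤
      B 0 * ((1 + ‖z.1‖) ^ M * (1 + ‖z.2‖) ^ M) * ((1 + ‖y‖) ^ M * ‖f y‖) := by
  rw [norm_mul, norm_mul, norm_weylPhase, one_mul]
  have h0 := hq.nonneg 0
  calc _ ≤ B 0 * ((1 + ‖z.1‖) ^ M * (1 + ‖z.2‖) ^ M * (1 + ‖y‖) ^ M) * ‖f y‖ := by
        gcongr
        refine (hq.norm_le _).trans ?_
        gcongr
        exact one_add_norm_midpointArg_pow_le M z y
    _ = _ := by ring

theorem SymbolBound.integrable_integrand (hq : SymbolBound M B q) (f : 𝓢(Space d, ℂ))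
    (z : PhaseSpace d) : Integrable fun y => weylPhase z y * q (midpointArg z y) * f y :=
  ((integrable_one_add_norm_pow_mul M f).const_mul
    (B 0 * ((1 + ‖z.1‖) ^ M * (1 + ‖z.2‖) ^ M))).mono'
    ((hq.continuous_integrand f).comp (by fun_prop : Continuous fun y : Space d =>
      (z, y))).aestronglyMeasurable
    (Filter.Eventually.of_forall (hq.norm_integrand_le f z))

theorem exists_norm_weylInner_le (M : ℕ) (B : ℕ → ℝ) : ∃ (C : ℝ) (j : ℕ), 0 ≤ C ∧
    ∀ q : PhaseSpace d → ℂ, SymbolBound M B q → ∀ (f : 𝓢(Space d, ℂ)) (z : PhaseSpace d),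
      ‖weylInner q f z‖ ≤ C * ((1 + ‖z.1‖) ^ M * (1 + ‖z.2‖) ^ M) * schwartzNorm j f := by
  obtain ⟨C, j, hC, h⟩ := exists_integral_one_add_norm_pow_mul_le (d := d) M
  refine ⟨|B 0| * C, j, by positivity, fun q hq f z => ?_⟩
  have h0 := hq.nonneg 0
  calc _ ≤ ∫ y, B 0 * ((1 + ‖z.1‖) ^ M * (1 + ‖z.2‖) ^ M) * ((1 + ‖y‖) ^ M * ‖f y‖) :=
        norm_integral_le_of_norm_le ((integrable_one_add_norm_pow_mul M f).const_mul _)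
          (Filter.Eventually.of_forall (hq.norm_integrand_le f z))
    _ ≤ B 0 * ((1 + ‖z.1‖) ^ M * (1 + ‖z.2‖) ^ M) * (C * schwartzNorm j f) := by
        rw [integral_const_mul]
        gcongr
        exact h f
    _ = _ := by rw [abs_of_nonneg h0]; ring

theorem hasFDerivAt_weylPhase (z : PhaseSpace d) (y : Space d) :
    HasFDerivAt (fun z => weylPhase z y)
      (weylPhase z y • (Complex.I • (Complex.ofRealCLM.comp
        ((innerSL ℝ (z.1 - y)).comp (ContinuousLinearMap.snd ℝ (Space d) (Space d)) +
          (innerSL ℝ z.2).comp (ContinuousLinearMap.fst ℝ (Space d) (Space d)))))) z := by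
  have h1 : HasFDerivAt (fun z : PhaseSpace d => inner ℝ (z.1 - y) z.2)
      ((innerSL ℝ (z.1 - y)).comp (ContinuousLinearMap.snd ℝ (Space d) (Space d)) +
          (innerSL ℝ z.2).comp (ContinuousLinearMap.fst ℝ (Space d) (Space d))) z := by
    have := HasFDerivAt.inner ℝ ((hasFDerivAt_fst (𝕜 := ℝ) (p := z)).sub_const y)
      (hasFDerivAt_snd (𝕜 := ℝ) (p := z))
    refine this.congr_fderiv ?_
    ext v <;> simp [real_inner_comm, inner_sub_left]
  have h2 := ((Complex.ofRealCLM.hasFDerivAt.comp z h1).mul_const Complex.I).cexp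
  exact h2

theorem hasFDerivAt_midpointArg (z : PhaseSpace d) (y : Space d) :
    HasFDerivAt (fun z => midpointArg z y)
      (((2⁻¹ : ℝ) • ContinuousLinearMap.fst ℝ (Space d) (Space d)).prod
        (ContinuousLinearMap.snd ℝ (Space d) (Space d))) z :=
  (((hasFDerivAt_fst (𝕜 := ℝ) (p := z)).add_const y).const_smul (2⁻¹ : ℝ)).prodMk
    (hasFDerivAt_snd (𝕜 := ℝ) (p := z))

theorem SymbolBound.fderiv_integrand_apply (hq : SymbolBound M B q) (c : ℂ)
    (z : PhaseSpace d) (y : Space d) (v : PhaseSpace d) :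
    fderiv ℝ (fun z => weylPhase z y * q (midpointArg z y) * c) z v =
      Complex.I * ((inner ℝ v.1 z.2 : ℝ) + (inner ℝ (z.1 - y) v.2 : ℝ)) *
        (weylPhase z y * q (midpointArg z y) * c) +
      weylPhase z y * symbolDeriv ((2⁻¹ : ℝ) • v.1, v.2) q (midpointArg z y) * c := by
  have h1 : HasFDerivAt (fun z => q (midpointArg z y)) _ z :=
    (hq.differentiable _).hasFDerivAt.comp z (hasFDerivAt_midpointArg z y)
  rw [(((hasFDerivAt_weylPhase z y).fun_mul h1).mul_const c).fderiv]
  simp [symbolDeriv, real_inner_comm, inner_sub_left]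
  ring

/-- Differentiating the phase produces `⟨v.1, ξ⟩ + ⟨x - y, v.2⟩`, which costs one power of each
weight; hence the exponent `M + 1` and the term `2 * B 0`. The symbol derivative gives `B 1`. -/
theorem SymbolBound.norm_fderiv_integrand_le (hq : SymbolBound M B q) (f : 𝓢(Space d, ℂ))
    (z : PhaseSpace d) (y : Space d) :
    ‖fderiv ℝ (fun z => weylPhase z y * q (midpointArg z y) * f y) z‖ ≤
      (2 * B 0 + B 1) * ((1 + ‖z.1‖) ^ (M + 1) * (1 + ‖z.2‖) ^ (M + 1)) *
        ((1 + ‖y‖) ^ (M + 1) * ‖f y‖) := by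
  have h0 := hq.nonneg 0
  have h1 := hq.nonneg 1
  refine ContinuousLinearMap.opNorm_le_bound _ (by positivity) fun v => ?_
  rw [hq.fderiv_integrand_apply]
  set P := (1 + ‖z.1‖) ^ M * (1 + ‖z.2‖) ^ M * ((1 + ‖y‖) ^ M * ‖f y‖) with hP
  have hPn : 0 ≤ P := by positivity
  set R := (1 + ‖z.1‖) * (1 + ‖z.2‖) * (1 + ‖y‖) with hR
  have a := norm_nonneg z.1
  have b := norm_nonneg z.2
  have c := norm_nonneg y
  have hR1 : 1 + ‖z.1‖ + ‖z.2‖ + ‖y‖ ≤ R := by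
    have : 0 ≤ ‖z.1‖ * ‖z.2‖ + ‖z.1‖ * ‖y‖ + ‖z.2‖ * ‖y‖ + ‖z.1‖ * ‖z.2‖ * ‖y‖ := by positivity
    rw [hR]
    linarith
  have e1 : ‖weylPhase z y * q (midpointArg z y) * f y‖ ≤ B 0 * P :=
    (hq.norm_integrand_le f z y).trans (le_of_eq (by rw [hP]; ring))
  have hv1 := norm_fst_le v
  have hv2 := norm_snd_le v
  have hvv : ‖((2⁻¹ : ℝ) • v.1, v.2)‖ ≤ ‖v‖ := by
    refine max_le ?_ hv2
    simp only [norm_smul]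
    norm_num
    linarith [norm_nonneg v.1]
  have e2 : ‖weylPhase z y * symbolDeriv ((2⁻¹ : ℝ) • v.1, v.2) q (midpointArg z y) * f y‖ ≤
      B 1 * P * ‖v‖ := by
    rw [norm_mul, norm_mul, norm_weylPhase, one_mul]
    calc _ ≤ (B 1 * ((1 + ‖z.1‖) ^ M * (1 + ‖z.2‖) ^ M * (1 + ‖y‖) ^ M) * ‖v‖) * ‖f y‖ := by
          gcongr
          refine (ContinuousLinearMap.le_opNorm _ _).trans ?_
          gcongr
          refine (hq.norm_fderiv_le _).trans ?_
          gcongr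
          exact one_add_norm_midpointArg_pow_le M z y
      _ = _ := by rw [hP]; ring
  have e3 : ‖Complex.I * (((inner ℝ v.1 z.2 : ℝ) : ℂ) + (inner ℝ (z.1 - y) v.2 : ℝ))‖ ≤
      2 * R * ‖v‖ := by
    rw [norm_mul, Complex.norm_I, one_mul, ← Complex.ofReal_add, Complex.norm_real]
    refine (norm_add_le _ _).trans ?_
    have i1 : ‖inner ℝ v.1 z.2‖ ≤ ‖v‖ * R :=
      (norm_inner_le_norm _ _).trans (mul_le_mul hv1 (by linarith) b (norm_nonneg _))
    have i2 : ‖inner ℝ (z.1 - y) v.2‖ ≤ R * ‖v‖ :=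
      (norm_inner_le_norm _ _).trans (mul_le_mul
        ((norm_sub_le _ _).trans (by linarith)) hv2 (norm_nonneg _) (by linarith))
    linarith
  calc _ ≤ 2 * R * ‖v‖ * (B 0 * P) + B 1 * P * ‖v‖ := by
        refine (norm_add_le _ _).trans (add_le_add ?_ e2)
        rw [norm_mul]
        exact mul_le_mul e3 e1 (norm_nonneg _) (by positivity)
    _ ≤ 2 * R * ‖v‖ * (B 0 * P) + R * (B 1 * P * ‖v‖) := by
        have hR2 : 1 ≤ R := by linarith
        exact add_le_add le_rfl (le_mul_of_one_le_left (by positivity) hR2)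
    _ = _ := by rw [hP, hR]; ring

theorem SymbolBound.differentiableAt_integrand (hq : SymbolBound M B q) (c : ℂ)
    (z : PhaseSpace d) (y : Space d) :
    DifferentiableAt ℝ (fun z => weylPhase z y * q (midpointArg z y) * c) z :=
  ((hasFDerivAt_weylPhase z y).differentiableAt.fun_mul
    ((hq.differentiable _).comp z (hasFDerivAt_midpointArg z y).differentiableAt)).mul_const c

theorem SymbolBound.integrable_fderiv_integrand (hq : SymbolBound M B q) (f : 𝓢(Space d, ℂ))
    (z : PhaseSpace d) :
    Integrable fun y => fderiv ℝ (fun z => weylPhase z y * q (midpointArg z y) * f y) z := by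
  refine ((integrable_one_add_norm_pow_mul (M + 1) f).const_mul
    ((2 * B 0 + B 1) * ((1 + ‖z.1‖) ^ (M + 1) * (1 + ‖z.2‖) ^ (M + 1)))).mono' ?_
    (Filter.Eventually.of_forall (hq.norm_fderiv_integrand_le f z))
  refine Continuous.aestronglyMeasurable ?_
  have h : ContDiff ℝ ∞ (Function.uncurry fun (y : Space d) (z : PhaseSpace d) =>
      weylPhase z y * q (midpointArg z y) * f y) :=
    (hq.contDiff_kernel.comp (contDiff_snd.prodMk contDiff_fst)).mul
      ((f.smooth ⊤).comp contDiff_fst)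
  exact (h.fderiv (n := 0) contDiff_const (by simp)).continuous

theorem SymbolBound.hasFDerivAt_weylInner (hq : SymbolBound M B q) (f : 𝓢(Space d, ℂ))
    (z : PhaseSpace d) :
    HasFDerivAt (weylInner q f)
      (∫ y, fderiv ℝ (fun z => weylPhase z y * q (midpointArg z y) * f y) z) z := by
  have h0 := hq.nonneg 0
  have h1 := hq.nonneg 1
  refine hasFDerivAt_integral_of_dominated_of_fderiv_le
    (F := fun z y => weylPhase z y * q (midpointArg z y) * f y)
    (F' := fun z y => fderiv ℝ (fun z => weylPhase z y * q (midpointArg z y) * f y) z)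
    (s := Metric.ball z 1)
    (bound := fun y => (2 * B 0 + B 1) * ((2 + ‖z‖) ^ (M + 1) * (2 + ‖z‖) ^ (M + 1)) *
        ((1 + ‖y‖) ^ (M + 1) * ‖f y‖))
    (Metric.ball_mem_nhds z one_pos)
    (Filter.Eventually.of_forall fun z' => (hq.integrable_integrand f z').1)
    (hq.integrable_integrand f z) (hq.integrable_fderiv_integrand f z).1
    (Filter.Eventually.of_forall fun y z' hz' => ?_)
    ((integrable_one_add_norm_pow_mul (M + 1) f).const_mul _)
    (Filter.Eventually.of_forall fun y z' _ =>
      (hq.differentiableAt_integrand (f y) z' y).hasFDerivAt)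
  have hz : ‖z'‖ ≤ 1 + ‖z‖ := by
    have := norm_add_le (z' - z) z
    rw [sub_add_cancel] at this
    have h2 : ‖z' - z‖ < 1 := by simpa [dist_eq_norm] using hz'
    linarith
  refine (hq.norm_fderiv_integrand_le f z' y).trans ?_
  have := norm_fst_le z'
  have := norm_snd_le z'
  have : 1 + ‖z'.1‖ ≤ 2 + ‖z‖ := by linarith
  have : 1 + ‖z'.2‖ ≤ 2 + ‖z‖ := by linarith
  gcongr

theorem SymbolBound.differentiable_weylInner (hq : SymbolBound M B q) (f : 𝓢(Space d, ℂ)) :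
    Differentiable ℝ (weylInner q f) := fun z => (hq.hasFDerivAt_weylInner f z).differentiableAt

theorem norm_half_le {v : PhaseSpace d} (hv : ‖v‖ ≤ 1) : ‖((2⁻¹ : ℝ) • v.1, v.2)‖ ≤ 1 := by
  refine max_le ?_ ((norm_snd_le v).trans hv)
  simp only [norm_smul]
  norm_num
  linarith [norm_fst_le v, norm_nonneg v.1]

/-- The `y` that the phase derivative brings down is given to `f` as a coordinate multiplication, so
every term is again an inner integral of the same kind. -/
theorem SymbolBound.fderiv_weylInner_apply (hq : SymbolBound M B q) (f : 𝓢(Space d, ℂ))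
    (z : PhaseSpace d) {v : PhaseSpace d} (hv : ‖v‖ ≤ 1) :
    fderiv ℝ (weylInner q f) z v =
      Complex.I * (((inner ℝ v.1 z.2 : ℝ) + (inner ℝ z.1 v.2 : ℝ)) * weylInner q f z -
        weylInner q (coordMul v.2 f) z) +
      weylInner (symbolDeriv ((2⁻¹ : ℝ) • v.1, v.2) q) f z := by
  rw [(hq.hasFDerivAt_weylInner f z).fderiv,
    ContinuousLinearMap.integral_apply (hq.integrable_fderiv_integrand f z)]
  have h1 := hq.integrable_integrand f z
  have h2 := hq.integrable_integrand (coordMul v.2 f) z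
  have h3 := (hq.directional (norm_half_le hv)).integrable_integrand f z
  simp only [weylInner]
  rw [← integral_const_mul, ← integral_sub (h1.const_mul _) h2, ← integral_const_mul,
    ← integral_add (((h1.const_mul _).sub' h2).const_mul _) h3]
  congr 1
  ext y
  rw [hq.fderiv_integrand_apply, coordMul_apply, inner_sub_left]
  push_cast
  ring

/-- Integration by parts in the inner integral. -/
theorem SymbolBound.freq_mul_weylInner (hq : SymbolBound M B q) (f : 𝓢(Space d, ℂ))
    (z : PhaseSpace d) {v : Space d} (hv : ‖v‖ ≤ 1) :
    Complex.I * (inner ℝ v z.2 : ℝ) * weylInner q f z =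
      weylInner (symbolDeriv ((2⁻¹ : ℝ) • v, 0) q) f z + weylInner q (∂_{v} f) z := by
  have hv' : ‖((2⁻¹ : ℝ) • v, (0 : Space d))‖ ≤ 1 :=
    norm_half_le (v := (v, 0)) (by simpa using hv)
  have hA : ∀ y, HasFDerivAt (fun y => midpointArg z y)
      (((2⁻¹ : ℝ) • ContinuousLinearMap.id ℝ (Space d)).prod 0) y := fun y =>
    (((hasFDerivAt_id (𝕜 := ℝ) y).const_add z.1).const_smul (2⁻¹ : ℝ)).prodMk
      (hasFDerivAt_const z.2 y)
  have hE : ∀ y, HasFDerivAt (fun y => weylPhase z y)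
      (weylPhase z y • (Complex.I • (Complex.ofRealCLM.comp (-(innerSL ℝ z.2))))) y := by
    intro y
    have h1 : HasFDerivAt (fun y : Space d => inner ℝ (z.1 - y) z.2) (-(innerSL ℝ z.2)) y := by
      have := HasFDerivAt.inner ℝ ((hasFDerivAt_id (𝕜 := ℝ) y).const_sub z.1)
        (hasFDerivAt_const z.2 y)
      refine this.congr_fderiv ?_
      ext v
      simp [real_inner_comm]
    exact ((Complex.ofRealCLM.hasFDerivAt.comp y h1).mul_const Complex.I).cexp
  have hd : ∀ y, HasFDerivAt (fun y => weylPhase z y * q (midpointArg z y)) _ y := fun y =>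
    (hE y).fun_mul ((hq.differentiable _).hasFDerivAt.comp y (hA y))
  have h1 := hq.integrable_integrand f z
  have h2 := hq.integrable_integrand (∂_{v} f) z
  have h3 := (hq.directional hv').integrable_integrand f z
  have hfd : ∀ y, fderiv ℝ (fun y => weylPhase z y * q (midpointArg z y)) y v * f y =
      -(Complex.I * (inner ℝ v z.2 : ℝ)) * (weylPhase z y * q (midpointArg z y) * f y) +
        weylPhase z y * symbolDeriv ((2⁻¹ : ℝ) • v, 0) q (midpointArg z y) * f y := by
    intro y
    rw [(hd y).fderiv]
    simp [symbolDeriv, real_inner_comm]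
    ring
  have h4 := integral_mul_fderiv_eq_neg_fderiv_mul_of_integrable (μ := volume)
    (f := fun y => weylPhase z y * q (midpointArg z y)) (g := f) (v := v)
    (by simp_rw [hfd]; exact (h1.const_mul _).add h3)
    (by simp_rw [← SchwartzMap.lineDerivOp_apply_eq_fderiv]; exact h2) h1
    (fun y _ => (hd y).differentiableAt) (fun y _ => f.differentiableAt)
  simp_rw [hfd, ← SchwartzMap.lineDerivOp_apply_eq_fderiv] at h4
  rw [integral_add (h1.const_mul _) h3, integral_const_mul] at h4
  have h5 : weylInner q (∂_{v} f) z =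
      ∫ y, weylPhase z y * q (midpointArg z y) * (∂_{v} f) y := rfl
  rw [h5, h4]
  simp only [weylInner]
  ring

/-- The inner integral decays rapidly in `ξ`, uniformly for symbols with given bounds. -/
theorem exists_pow_mul_norm_weylInner_le (M : ℕ) (B : ℕ → ℝ) (k : ℕ) :
    ∃ (C : ℝ) (j : ℕ), 0 ≤ C ∧ ∀ q : PhaseSpace d → ℂ, SymbolBound M B q →
      ∀ (f : 𝓢(Space d, ℂ)) (z : PhaseSpace d), (1 + ‖z.2‖) ^ k * ‖weylInner q f z‖ ≤
        C * ((1 + ‖z.1‖) ^ M * (1 + ‖z.2‖) ^ M) * schwartzNorm j f := by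
  induction k generalizing B with
  | zero => simpa using exists_norm_weylInner_le M B
  | succ k ih =>
    obtain ⟨C, j, hC, h⟩ := ih B
    obtain ⟨C', j', hC', h'⟩ := ih fun n => B (n + 1)
    refine ⟨2 * C + C', j + j' + 1, by positivity, fun q hq f z => ?_⟩
    obtain ⟨v, hv, hvz⟩ := exists_norm_le_one_inner_eq z.2
    have hv' : ‖((2⁻¹ : ℝ) • v, (0 : Space d))‖ ≤ 1 :=
      norm_half_le (v := (v, 0)) (by simpa using hv)
    have e : ‖z.2‖ * ‖weylInner q f z‖ ≤
        ‖weylInner (symbolDeriv ((2⁻¹ : ℝ) • v, 0) q) f z‖ + ‖weylInner q (∂_{v} f) z‖ := by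
      have := hq.freq_mul_weylInner f z hv
      rw [real_inner_comm, hvz] at this
      have h2 := congrArg norm this
      rw [norm_mul, norm_mul, Complex.norm_real, norm_norm, Complex.norm_I, one_mul] at h2
      rw [h2]
      exact norm_add_le _ _
    set W := (1 + ‖z.1‖) ^ M * (1 + ‖z.2‖) ^ M
    have hW : 0 ≤ W := by positivity
    have m1 : schwartzNorm j f ≤ schwartzNorm (j + j' + 1) f := schwartzNorm_mono (by omega) f
    have m2 : schwartzNorm j' f ≤ schwartzNorm (j + j' + 1) f := schwartzNorm_mono (by omega) f
    have m3 : schwartzNorm j (∂_{v} f) ≤ schwartzNorm (j + j' + 1) f :=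
      (schwartzNorm_lineDerivOp_le j f hv).trans (schwartzNorm_mono (by omega) f)
    calc _ = (1 + ‖z.2‖) ^ k * (‖weylInner q f z‖ + ‖z.2‖ * ‖weylInner q f z‖) := by ring
      _ ≤ (1 + ‖z.2‖) ^ k * (‖weylInner q f z‖ +
          (‖weylInner (symbolDeriv ((2⁻¹ : ℝ) • v, 0) q) f z‖ + ‖weylInner q (∂_{v} f) z‖)) := by
          gcongr
      _ = (1 + ‖z.2‖) ^ k * ‖weylInner q f z‖ +
          ((1 + ‖z.2‖) ^ k * ‖weylInner (symbolDeriv ((2⁻¹ : ℝ) • v, 0) q) f z‖ +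
            (1 + ‖z.2‖) ^ k * ‖weylInner q (∂_{v} f) z‖) := by ring
      _ ≤ C * W * schwartzNorm (j + j' + 1) f + (C' * W * schwartzNorm (j + j' + 1) f +
            C * W * schwartzNorm (j + j' + 1) f) := by
          refine add_le_add ?_ (add_le_add ?_ ?_)
          · exact (h q hq f z).trans (by gcongr)
          · exact (h' _ (hq.directional hv') f z).trans (by gcongr)
          · exact (h q hq _ z).trans (by gcongr)
      _ = _ := by ring

end Inner

/-! ### Continuity of the Weyl quantization on the Schwartz space -/

theorem weylValue_eq (q : PhaseSpace d → ℂ) (f : 𝓢(Space d, ℂ)) (x : Space d) :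
    weylValue q f x = ((2 * Real.pi) ^ d : ℝ)⁻¹ • ∫ ξ : Space d, weylInner q f (x, ξ) := rfl

/-- Since the loss `(1 + ‖ξ‖)^M` does not depend on the number of powers gained, gaining `M + (d +
1)` of them leaves an integrable majorant in `ξ`. -/
theorem exists_norm_weylInner_le_inv (M : ℕ) (B : ℕ → ℝ) : ∃ (C : ℝ) (j : ℕ), 0 ≤ C ∧
    ∀ q : PhaseSpace d → ℂ, SymbolBound M B q → ∀ (f : 𝓢(Space d, ℂ)) (z : PhaseSpace d),
      ‖weylInner q f z‖ ≤
        C * (1 + ‖z.1‖) ^ M * schwartzNorm j f * ((1 + ‖z.2‖) ^ (d + 1))⁻¹ := by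
  obtain ⟨C, j, hC, h⟩ := exists_pow_mul_norm_weylInner_le (d := d) M B (M + (d + 1))
  refine ⟨C, j, hC, fun q hq f z => ?_⟩
  rw [← div_eq_mul_inv, le_div_iff₀ (by positivity)]
  have hpos : 0 < (1 + ‖z.2‖) ^ M := by positivity
  refine le_of_mul_le_mul_left ?_ hpos
  calc _ = (1 + ‖z.2‖) ^ (M + (d + 1)) * ‖weylInner q f z‖ := by ring
    _ ≤ _ := h q hq f z
    _ = _ := by ring

section

variable {M : ℕ} {B : ℕ → ℝ} {q : PhaseSpace d → ℂ}

theorem SymbolBound.integrable_weylInner (hq : SymbolBound M B q) (f : 𝓢(Space d, ℂ))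
    (x : Space d) : Integrable fun ξ => weylInner q f (x, ξ) := by
  obtain ⟨C, j, hC, h⟩ := exists_norm_weylInner_le_inv (d := d) M B
  exact (integrable_one_add_norm_pow_inv.const_mul
    (C * (1 + ‖x‖) ^ M * schwartzNorm j f)).mono'
    ((hq.differentiable_weylInner f).continuous.comp
      (by fun_prop : Continuous fun ξ : Space d => (x, ξ))).aestronglyMeasurable
    (Filter.Eventually.of_forall fun ξ => h q hq f (x, ξ))

theorem exists_norm_weylValue_le (M : ℕ) (B : ℕ → ℝ) : ∃ (C : ℝ) (j : ℕ), 0 ≤ C ∧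
    ∀ q : PhaseSpace d → ℂ, SymbolBound M B q → ∀ (f : 𝓢(Space d, ℂ)) (x : Space d),
      ‖weylValue q f x‖ ≤ C * (1 + ‖x‖) ^ M * schwartzNorm j f := by
  obtain ⟨C, j, hC, h⟩ := exists_norm_weylInner_le_inv (d := d) M B
  have hI : 0 ≤ ∫ ξ : Space d, ((1 + ‖ξ‖) ^ (d + 1))⁻¹ := integral_nonneg fun y => by positivity
  refine ⟨‖((2 * Real.pi) ^ d : ℝ)⁻¹‖ * (C * ∫ ξ : Space d, ((1 + ‖ξ‖) ^ (d + 1))⁻¹), j,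
    by positivity, fun q hq f x => ?_⟩
  rw [weylValue_eq, norm_smul]
  calc _ ≤ ‖((2 * Real.pi) ^ d : ℝ)⁻¹‖ * ∫ ξ : Space d,
          C * (1 + ‖x‖) ^ M * schwartzNorm j f * ((1 + ‖ξ‖) ^ (d + 1))⁻¹ := by
        gcongr
        exact norm_integral_le_of_norm_le (integrable_one_add_norm_pow_inv.const_mul _)
          (Filter.Eventually.of_forall fun ξ => h q hq f (x, ξ))
    _ = _ := by rw [integral_const_mul]; ring

/-- The unbounded factor `⟨v, ξ⟩` from the phase is removed by integration by parts. Its symbol term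
coincides with the one from the midpoint, whence the 2, which cancels the `2⁻¹`. -/
theorem SymbolBound.fderiv_weylInner_left (hq : SymbolBound M B q) (f : 𝓢(Space d, ℂ))
    (z : PhaseSpace d) {v : Space d} (hv : ‖v‖ ≤ 1) :
    fderiv ℝ (weylInner q f) z (v, 0) =
      2 * weylInner (symbolDeriv ((2⁻¹ : ℝ) • v, 0) q) f z + weylInner q (∂_{v} f) z := by
  rw [hq.fderiv_weylInner_apply f z (v := (v, 0)) (by simpa using hv)]
  have h1 := hq.freq_mul_weylInner f z hv
  have h2 : weylInner q (coordMul (0 : Space d) f) z = 0 := by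
    simp [weylInner, coordMul_apply]
  simp only [h2, inner_zero_right, Complex.ofReal_zero, add_zero, sub_zero]
  rw [← mul_assoc, h1]
  ring

theorem SymbolBound.integrable_fderiv_weylInner (hq : SymbolBound M B q) (f : 𝓢(Space d, ℂ))
    (x : Space d) {v : PhaseSpace d} (hv : ‖v‖ ≤ 1) (hv1 : v.1 = 0) :
    Integrable fun ξ => fderiv ℝ (weylInner q f) (x, ξ) v := by
  simp_rw [fun ξ => hq.fderiv_weylInner_apply f (x, ξ) hv, hv1]
  simp only [inner_zero_left, Complex.ofReal_zero, zero_add]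
  refine ((((hq.integrable_weylInner f x).const_mul _).sub'
    (hq.integrable_weylInner _ x)).const_mul _).add ?_
  refine (hq.directional ?_).integrable_weylInner f x
  simpa [hv1] using norm_half_le hv

/-- The integral over `ξ` of a `ξ`-derivative vanishes. As the phase contributes `i⟨x - y, w⟩`, this
trades a factor `⟨x, w⟩` for one on `f` and a derivative of the symbol. -/
theorem SymbolBound.pos_mul_weylValue (hq : SymbolBound M B q) (f : 𝓢(Space d, ℂ))
    (x : Space d) {w : Space d} (hw : ‖w‖ ≤ 1) :
    ((inner ℝ x w : ℝ) : ℂ) * weylValue q f x =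
      weylValue q (coordMul w f) x + Complex.I * weylValue (symbolDeriv (0, w) q) f x := by
  have hv : ‖((0 : Space d), w)‖ ≤ 1 := by simpa using hw
  have hslice : ∀ ξ, HasFDerivAt (fun ξ => weylInner q f (x, ξ))
      ((fderiv ℝ (weylInner q f) (x, ξ)).comp (ContinuousLinearMap.inr ℝ (Space d) (Space d))) ξ :=
    fun ξ => (hq.differentiable_weylInner f (x, ξ)).hasFDerivAt.comp ξ
      (hasFDerivAt_prodMk_right x ξ)
  have happ : ∀ ξ, fderiv ℝ (fun ξ => weylInner q f (x, ξ)) ξ w =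
      fderiv ℝ (weylInner q f) (x, ξ) (0, w) := fun ξ => by
    rw [(hslice ξ).fderiv]; simp
  have h0 : ∫ ξ, fderiv ℝ (weylInner q f) (x, ξ) (0, w) = 0 := by
    have := integral_mul_fderiv_eq_neg_fderiv_mul_of_integrable (μ := volume)
      (f := fun _ : Space d => (1 : ℂ)) (g := fun ξ => weylInner q f (x, ξ)) (v := w)
      (by simp) (by simp_rw [happ, one_mul]; exact hq.integrable_fderiv_weylInner f x hv rfl)
      (by simpa using hq.integrable_weylInner f x)
      (fun _ _ => by fun_prop) (fun ξ _ => (hslice ξ).differentiableAt)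
    simpa [happ] using this
  simp_rw [fun ξ => hq.fderiv_weylInner_apply f (x, ξ) hv] at h0
  simp only [inner_zero_left, Complex.ofReal_zero, zero_add, smul_zero] at h0
  have i1 := hq.integrable_weylInner f x
  have i2 := hq.integrable_weylInner (coordMul w f) x
  have i3 := (hq.directional hv).integrable_weylInner f x
  rw [integral_add (((i1.const_mul _).sub' i2).const_mul _) i3, integral_const_mul,
    integral_sub (i1.const_mul _) i2, integral_const_mul] at h0
  simp only [weylValue_eq, Complex.real_smul]
  have h1 : ∀ A D E : ℂ, Complex.I * (A - D) + E = 0 → A = D + Complex.I * E := fun A D E h => by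
    linear_combination (-Complex.I) * h + (A - D) * Complex.I_sq
  have h2 := h1 _ _ _ h0
  linear_combination ((((2 * Real.pi) ^ d : ℝ)⁻¹ : ℝ) : ℂ) * h2

theorem exists_pow_mul_norm_weylValue_le (M : ℕ) (B : ℕ → ℝ) (k : ℕ) :
    ∃ (C : ℝ) (j : ℕ), 0 ≤ C ∧ ∀ q : PhaseSpace d → ℂ, SymbolBound M B q →
      ∀ (f : 𝓢(Space d, ℂ)) (x : Space d),
        (1 + ‖x‖) ^ k * ‖weylValue q f x‖ ≤ C * (1 + ‖x‖) ^ M * schwartzNorm j f := by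
  induction k generalizing B with
  | zero => simpa using exists_norm_weylValue_le M B
  | succ k ih =>
    obtain ⟨C, j, hC, h⟩ := ih B
    obtain ⟨C', j', hC', h'⟩ := ih fun n => B (n + 1)
    obtain ⟨D, j'', hD, hX⟩ := exists_schwartzNorm_coordMul_le (d := d) j
    refine ⟨C + (C * D + C'), j + j' + j'', by positivity, fun q hq f x => ?_⟩
    obtain ⟨v, hv, hvx⟩ := exists_norm_le_one_inner_eq x
    have hv' : ‖((0 : Space d), v)‖ ≤ 1 := by simpa using hv
    have e : ‖x‖ * ‖weylValue q f x‖ ≤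
        ‖weylValue q (coordMul v f) x‖ + ‖weylValue (symbolDeriv (0, v) q) f x‖ := by
      have := hq.pos_mul_weylValue f x hv
      rw [hvx] at this
      have h2 := congrArg norm this
      rw [norm_mul, Complex.norm_real, norm_norm] at h2
      rw [h2]
      refine (norm_add_le _ _).trans (le_of_eq ?_)
      rw [norm_mul, Complex.norm_I, one_mul]
    set J := j + j' + j''
    have m1 : schwartzNorm j f ≤ schwartzNorm J f := schwartzNorm_mono (by omega) f
    have m2 : schwartzNorm j' f ≤ schwartzNorm J f := schwartzNorm_mono (by omega) f
    have m3 : schwartzNorm j (coordMul v f) ≤ D * schwartzNorm J f :=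
      (hX v hv f).trans (by gcongr; exact schwartzNorm_mono (by omega) f)
    calc _ = (1 + ‖x‖) ^ k * (‖weylValue q f x‖ + ‖x‖ * ‖weylValue q f x‖) := by ring
      _ ≤ (1 + ‖x‖) ^ k * (‖weylValue q f x‖ +
          (‖weylValue q (coordMul v f) x‖ + ‖weylValue (symbolDeriv (0, v) q) f x‖)) := by
          gcongr
      _ = (1 + ‖x‖) ^ k * ‖weylValue q f x‖ +
          ((1 + ‖x‖) ^ k * ‖weylValue q (coordMul v f) x‖ +
            (1 + ‖x‖) ^ k * ‖weylValue (symbolDeriv (0, v) q) f x‖) := by ring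
      _ ≤ C * (1 + ‖x‖) ^ M * schwartzNorm J f +
          (C * (1 + ‖x‖) ^ M * (D * schwartzNorm J f) +
            C' * (1 + ‖x‖) ^ M * schwartzNorm J f) := by
          refine add_le_add ?_ (add_le_add ?_ ?_)
          · exact (h q hq f x).trans (by gcongr)
          · exact (h q hq _ x).trans (by gcongr)
          · exact (h' _ (hq.directional hv') f x).trans (by gcongr)
      _ = _ := by ring

theorem SymbolBound.hasFDerivAt_weylValue (hq : SymbolBound M B q) (f : 𝓢(Space d, ℂ))
    (x : Space d) : HasFDerivAt (weylValue q f) (((2 * Real.pi) ^ d : ℝ)⁻¹ •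
      ∫ ξ : Space d, (fderiv ℝ (weylInner q f) (x, ξ)).comp
        (ContinuousLinearMap.inl ℝ (Space d) (Space d))) x ∧
      Integrable fun ξ : Space d => (fderiv ℝ (weylInner q f) (x, ξ)).comp
        (ContinuousLinearMap.inl ℝ (Space d) (Space d)) := by
  obtain ⟨C, j, hC, h⟩ := exists_norm_weylInner_le_inv (d := d) M B
  obtain ⟨C', j', hC', h'⟩ := exists_norm_weylInner_le_inv (d := d) M fun n => B (n + 1)
  set J := j + 1 + j'
  have hN := schwartzNorm_nonneg J f
  have hbound : ∀ (x ξ : Space d), ‖(fderiv ℝ (weylInner q f) (x, ξ)).comp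
      (ContinuousLinearMap.inl ℝ (Space d) (Space d))‖ ≤
      (2 * C' + C) * schwartzNorm J f * (1 + ‖x‖) ^ M * ((1 + ‖ξ‖) ^ (d + 1))⁻¹ := by
    intro x ξ
    refine ContinuousLinearMap.opNorm_le_of_unit_norm (by positivity) fun v hv => ?_
    have hv' : ‖((2⁻¹ : ℝ) • v, (0 : Space d))‖ ≤ 1 :=
      norm_half_le (v := (v, 0)) (by simpa using hv.le)
    rw [ContinuousLinearMap.comp_apply, ContinuousLinearMap.inl_apply,
      hq.fderiv_weylInner_left f (x, ξ) hv.le]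
    have m2 : schwartzNorm j' f ≤ schwartzNorm J f := schwartzNorm_mono (by omega) f
    have m3 : schwartzNorm j (∂_{v} f) ≤ schwartzNorm J f :=
      (schwartzNorm_lineDerivOp_le j f hv.le).trans (schwartzNorm_mono (by omega) f)
    have e1 := h' _ (hq.directional hv') f (x, ξ)
    have e2 := h q hq (∂_{v} f) (x, ξ)
    calc _ ≤ 2 * ‖weylInner (symbolDeriv ((2⁻¹ : ℝ) • v, 0) q) f (x, ξ)‖ +
          ‖weylInner q (∂_{v} f) (x, ξ)‖ := by
          refine (norm_add_le _ _).trans (le_of_eq ?_)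
          rw [norm_mul]; norm_num
      _ ≤ 2 * (C' * (1 + ‖x‖) ^ M * schwartzNorm J f * ((1 + ‖ξ‖) ^ (d + 1))⁻¹) +
          C * (1 + ‖x‖) ^ M * schwartzNorm J f * ((1 + ‖ξ‖) ^ (d + 1))⁻¹ := by
          refine add_le_add (mul_le_mul_of_nonneg_left (e1.trans ?_) (by norm_num))
            (e2.trans ?_)
          · simp only; gcongr
          · simp only; gcongr
      _ = _ := by ring
  -- Only differentiability of the inner integral has been proved, so the argument uses
  -- measurability of a Fréchet derivative in place of its continuity.
  have hmeas : ∀ x : Space d, AEStronglyMeasurable (fun ξ : Space d =>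
      (fderiv ℝ (weylInner q f) (x, ξ)).comp (ContinuousLinearMap.inl ℝ (Space d) (Space d)))
      volume := by
    intro x
    have h1 : Measurable fun ξ : Space d => fderiv ℝ (weylInner q f) (x, ξ) :=
      (measurable_fderiv ℝ (weylInner q f)).comp (by fun_prop)
    have h2 : Continuous fun L : PhaseSpace d →L[ℝ] ℂ =>
        L.comp (ContinuousLinearMap.inl ℝ (Space d) (Space d)) := by fun_prop
    have : SecondCountableTopology (PhaseSpace d →L[ℝ] ℂ) :=
      haveI := FiniteDimensional.proper ℝ (PhaseSpace d →L[ℝ] ℂ)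
      inferInstance
    exact h2.comp_aestronglyMeasurable h1.aestronglyMeasurable
  have hbi : ∀ c : ℝ, Integrable fun ξ : Space d =>
      c * ((1 + ‖ξ‖) ^ (d + 1))⁻¹ := fun c => integrable_one_add_norm_pow_inv.const_mul c
  have hslice : ∀ x' ξ : Space d, HasFDerivAt (fun x => weylInner q f (x, ξ))
      ((fderiv ℝ (weylInner q f) (x', ξ)).comp
        (ContinuousLinearMap.inl ℝ (Space d) (Space d))) x' := fun x' ξ =>
    HasFDerivAt.comp (g := weylInner q f) (f := fun e : Space d => (e, ξ)) x'
      (hq.differentiable_weylInner f (x', ξ)).hasFDerivAt (hasFDerivAt_prodMk_left x' ξ)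
  refine ⟨?_, (hbi _).mono' (hmeas x) (Filter.Eventually.of_forall (hbound x))⟩
  have key : HasFDerivAt (fun x => ∫ ξ : Space d, weylInner q f (x, ξ))
      (∫ ξ : Space d, (fderiv ℝ (weylInner q f) (x, ξ)).comp
        (ContinuousLinearMap.inl ℝ (Space d) (Space d))) x := by
    refine hasFDerivAt_integral_of_dominated_of_fderiv_le
      (F := fun x ξ => weylInner q f (x, ξ))
      (F' := fun x ξ => (fderiv ℝ (weylInner q f) (x, ξ)).comp
        (ContinuousLinearMap.inl ℝ (Space d) (Space d)))
      (s := Metric.ball x 1)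
      (bound := fun ξ => (2 * C' + C) * schwartzNorm J f * (2 + ‖x‖) ^ M *
        ((1 + ‖ξ‖) ^ (d + 1))⁻¹)
      (Metric.ball_mem_nhds x one_pos)
      (Filter.Eventually.of_forall fun x' => (hq.integrable_weylInner f x').1)
      (hq.integrable_weylInner f x) (hmeas x)
      (Filter.Eventually.of_forall fun ξ x' hx' => (hbound x' ξ).trans ?_) (hbi _)
      (Filter.Eventually.of_forall fun ξ x' _ => hslice x' ξ)
    have hz : 1 + ‖x'‖ ≤ 2 + ‖x‖ := by
      have := norm_add_le (x' - x) x
      rw [sub_add_cancel] at this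
      have h2 : ‖x' - x‖ < 1 := by simpa [dist_eq_norm] using hx'
      linarith
    gcongr
  exact key.const_smul ((2 * Real.pi) ^ d : ℝ)⁻¹

theorem SymbolBound.fderiv_weylValue_apply (hq : SymbolBound M B q) (f : 𝓢(Space d, ℂ))
    (x : Space d) {v : Space d} (hv : ‖v‖ ≤ 1) :
    fderiv ℝ (weylValue q f) x v =
      2 * weylValue (symbolDeriv ((2⁻¹ : ℝ) • v, 0) q) f x + weylValue q (∂_{v} f) x := by
  obtain ⟨h1, h2⟩ := hq.hasFDerivAt_weylValue f x
  have hv' : ‖((2⁻¹ : ℝ) • v, (0 : Space d))‖ ≤ 1 :=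
    norm_half_le (v := (v, 0)) (by simpa using hv)
  rw [h1.fderiv, smul_apply, ContinuousLinearMap.integral_apply h2]
  simp only [ContinuousLinearMap.comp_apply, ContinuousLinearMap.inl_apply]
  simp_rw [fun ξ => hq.fderiv_weylInner_left f (x, ξ) hv]
  rw [integral_add (((hq.directional hv').integrable_weylInner f x).const_mul _)
    (hq.integrable_weylInner _ x), integral_const_mul]
  simp only [weylValue_eq, Complex.real_smul]
  ring

/-! ### Linearity in the function and in the symbol -/

theorem weylValue_smul (q : PhaseSpace d → ℂ) (c : ℂ) (f : 𝓢(Space d, ℂ)) (x : Space d) :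
    weylValue q (c • f) x = c * weylValue q f x := by
  have : ∀ z, weylInner q (c • f) z = c * weylInner q f z := fun z => by
    simp only [weylInner]
    rw [← integral_const_mul]
    congr 1
    ext y
    simp
    ring
  simp only [weylValue_eq, this, integral_const_mul, Complex.real_smul]
  ring

theorem weylValue_const_mul (q : PhaseSpace d → ℂ) (c : ℂ) (f : 𝓢(Space d, ℂ)) (x : Space d) :
    weylValue (fun w => c * q w) f x = c * weylValue q f x := by
  have : ∀ z, weylInner (fun w => c * q w) f z = c * weylInner q f z := fun z => by
    simp only [weylInner]
    rw [← integral_const_mul]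
    congr 1
    ext y
    ring
  simp only [weylValue_eq, this, integral_const_mul, Complex.real_smul]
  ring

theorem SymbolBound.weylValue_add (hq : SymbolBound M B q) (f g : 𝓢(Space d, ℂ)) (x : Space d) :
    weylValue q (f + g) x = weylValue q f x + weylValue q g x := by
  have : ∀ z, weylInner q (f + g) z = weylInner q f z + weylInner q g z := fun z => by
    simp only [weylInner]
    rw [← integral_add (hq.integrable_integrand f z) (hq.integrable_integrand g z)]
    congr 1
    ext y
    simp [mul_add]
  simp only [weylValue_eq, this]
  rw [integral_add (hq.integrable_weylInner f x) (hq.integrable_weylInner g x), smul_add]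

theorem SymbolBound.weylValue_symbol_add {M' : ℕ} {B' : ℕ → ℝ} {q' : PhaseSpace d → ℂ}
    (hq : SymbolBound M B q) (hq' : SymbolBound M' B' q') (f : 𝓢(Space d, ℂ)) (x : Space d) :
    weylValue (fun w => q w + q' w) f x = weylValue q f x + weylValue q' f x := by
  have : ∀ z, weylInner (fun w => q w + q' w) f z = weylInner q f z + weylInner q' f z :=
    fun z => by
    simp only [weylInner]
    rw [← integral_add (hq.integrable_integrand f z) (hq'.integrable_integrand f z)]
    congr 1
    ext y
    ring
  simp only [weylValue_eq, this]
  rw [integral_add (hq.integrable_weylInner f x) (hq'.integrable_weylInner f x), smul_add]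

/-! ### Smoothness and decay of all derivatives -/

theorem SymbolBound.differentiable_weylValue (hq : SymbolBound M B q) (f : 𝓢(Space d, ℂ)) :
    Differentiable ℝ (weylValue q f) := fun x => (hq.hasFDerivAt_weylValue f x).1.differentiableAt

theorem SymbolBound.fderiv_weylValue_eq (hq : SymbolBound M B q) (f : 𝓢(Space d, ℂ))
    {v : Space d} (hv : ‖v‖ ≤ 1) :
    (fun x => fderiv ℝ (weylValue q f) x v) =
      weylValue (symbolDeriv ((2⁻¹ : ℝ) • v, 0) q) ((2 : ℂ) • f) + weylValue q (∂_{v} f) := by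
  ext x
  rw [hq.fderiv_weylValue_apply f x hv, Pi.add_apply, weylValue_smul]

/-- Directional derivatives are sums of values of the same kind, so induction works once symbol,
constants and function all vary. -/
theorem SymbolBound.contDiff_weylValue (hq : SymbolBound M B q) (f : 𝓢(Space d, ℂ)) :
    ContDiff ℝ ∞ (weylValue q f) := by
  rw [contDiff_infty]
  intro n
  induction n generalizing B q f with
  | zero => exact contDiff_zero.2 (hq.differentiable_weylValue f).continuous
  | succ n ih =>
    rw [Nat.cast_succ, contDiff_succ_iff_fderiv_apply]
    refine ⟨hq.differentiable_weylValue f, by simp, fun v => ?_⟩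
    have hunit : ∀ v : Space d, ‖v‖ ≤ 1 →
        ContDiff ℝ n fun x => fderiv ℝ (weylValue q f) x v := fun v hv => by
      rw [hq.fderiv_weylValue_eq f hv]
      exact (ih (hq.directional (norm_half_le (v := (v, 0)) (by simpa using hv))) _).add (ih hq _)
    rcases eq_or_ne v 0 with rfl | hv
    · simpa using hunit 0 (by simp)
    · have h1 := contDiff_const (c := ‖v‖) |>.smul
        (hunit ((‖v‖⁻¹ : ℝ) • v) (by rw [norm_smul]; simp [hv]))
      convert! h1 using 2 with x
      simp [hv]

end

theorem exists_norm_iteratedFDeriv_weylValue_le (M : ℕ) (B : ℕ → ℝ) (k n : ℕ) :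
    ∃ (C : ℝ) (j : ℕ), 0 ≤ C ∧ ∀ q : PhaseSpace d → ℂ, SymbolBound M B q →
      ∀ (f : 𝓢(Space d, ℂ)) (x : Space d),
        ‖x‖ ^ k * ‖iteratedFDeriv ℝ n (weylValue q f) x‖ ≤ C * schwartzNorm j f := by
  induction n generalizing B with
  | zero =>
    -- The extra `M` powers cancel the loss `(1 + ‖x‖)^M`.
    obtain ⟨C, j, hC, h⟩ := exists_pow_mul_norm_weylValue_le (d := d) M B (M + k)
    refine ⟨C, j, hC, fun q hq f x => ?_⟩
    rw [norm_iteratedFDeriv_zero]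
    have hpos : 0 < (1 + ‖x‖) ^ M := by positivity
    refine le_of_mul_le_mul_left ?_ hpos
    calc _ ≤ (1 + ‖x‖) ^ M * ((1 + ‖x‖) ^ k * ‖weylValue q f x‖) := by
          gcongr
          linarith [norm_nonneg x]
      _ = (1 + ‖x‖) ^ (M + k) * ‖weylValue q f x‖ := by ring
      _ ≤ _ := h q hq f x
      _ = _ := by ring
  | succ n ih =>
    obtain ⟨C, j, hC, h⟩ := ih B
    obtain ⟨C', j', hC', h'⟩ := ih fun n => B (n + 1)
    refine ⟨2 * C' + C, j + 1 + j', by positivity, fun q hq f x => ?_⟩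
    have hN := schwartzNorm_nonneg (j + 1 + j') f
    rcases eq_or_ne (‖x‖ ^ k) 0 with h0 | h0
    · rw [h0, zero_mul]; positivity
    have h0' : 0 < ‖x‖ ^ k := lt_of_le_of_ne (by positivity) h0.symm
    rw [← le_div_iff₀' h0']
    refine norm_iteratedFDeriv_succ_le (hq.contDiff_weylValue f) n x fun v hv => ?_
    have hd := hq.directional (norm_half_le (v := (v, (0 : Space d))) (by simpa using hv))
    have hsm : ∀ {g : Space d → ℂ}, ContDiff ℝ ∞ g → ContDiffAt ℝ n g x := fun hg =>
      (hg.of_le (by exact_mod_cast le_top)).contDiffAt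
    rw [le_div_iff₀' h0', hq.fderiv_weylValue_eq f hv,
      iteratedFDeriv_add_apply (hsm (hd.contDiff_weylValue _)) (hsm (hq.contDiff_weylValue _))]
    calc _ ≤ ‖x‖ ^ k * (‖iteratedFDeriv ℝ n
            (weylValue (symbolDeriv ((2⁻¹ : ℝ) • v, 0) q) ((2 : ℂ) • f)) x‖ +
            ‖iteratedFDeriv ℝ n (weylValue q (∂_{v} f)) x‖) := by
            gcongr
            exact norm_add_le _ _
      _ ≤ C' * schwartzNorm j' ((2 : ℂ) • f) + C * schwartzNorm j (∂_{v} f) := by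
            rw [mul_add]
            exact add_le_add (h' _ hd _ x) (h q hq _ x)
      _ ≤ C' * (2 * schwartzNorm (j + 1 + j') f) + C * schwartzNorm (j + 1 + j') f := by
            rw [map_smul_eq_mul]
            gcongr
            · simp
            · exact schwartzNorm_mono (by omega) f
            · exact (schwartzNorm_lineDerivOp_le j f hv).trans (schwartzNorm_mono (by omega) f)
      _ = _ := by ring

/-! ### The operator on the Schwartz space and its covariance -/

section

variable {M : ℕ} {B : ℕ → ℝ} {q : PhaseSpace d → ℂ}

theorem SymbolBound.weylOp_apply (hq : SymbolBound M B q) (f : 𝓢(Space d, ℂ)) (x : Space d) :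
    weylOp q f x = weylValue q f x := by
  have hex : ∃ g : 𝓢(Space d, ℂ), ∀ x, g x = weylValue q f x :=
    ⟨{ toFun := weylValue q f
       smooth' := hq.contDiff_weylValue f
       decay' := fun k n => by
        obtain ⟨C, j, -, h⟩ := exists_norm_iteratedFDeriv_weylValue_le (d := d) M B k n
        exact ⟨C * schwartzNorm j f, h q hq f⟩ }, fun _ => rfl⟩
  rw [weylOp, dif_pos hex]
  exact hex.choose_spec x

/-- The Weyl quantization is continuous on the Schwartz space, uniformly for symbols with given
bounds. -/
theorem exists_schwartzNorm_weylOp_le (M : ℕ) (B : ℕ → ℝ) (j : ℕ) :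
    ∃ (C : ℝ) (j' : ℕ), 0 ≤ C ∧ ∀ q : PhaseSpace d → ℂ, SymbolBound M B q →
      ∀ f : 𝓢(Space d, ℂ), schwartzNorm j (weylOp q f) ≤ C * schwartzNorm j' f := by
  obtain ⟨C, K, j', hC, h⟩ := exists_schwartzNorm_le
    (ι := {q : PhaseSpace d → ℂ // SymbolBound M B q})
    (w := fun _ => 1) (T := fun q f => weylOp q.1 f) (fun _ => le_rfl) (fun k n => by
      obtain ⟨C, j, -, h⟩ := exists_norm_iteratedFDeriv_weylValue_le (d := d) M B k n
      refine ⟨C, 0, j, fun q f x => ?_⟩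
      rw [show ⇑(weylOp q.1 f) = weylValue q.1 f from funext (q.2.weylOp_apply f)]
      simpa using h q.1 q.2 f x) j
  exact ⟨C, j', hC, fun q hq f => by simpa using h ⟨q, hq⟩ f⟩

theorem SymbolBound.weylOp_add (hq : SymbolBound M B q) (f g : 𝓢(Space d, ℂ)) :
    weylOp q (f + g) = weylOp q f + weylOp q g := by
  ext x
  simp [hq.weylOp_apply, hq.weylValue_add]

theorem SymbolBound.weylOp_smul (hq : SymbolBound M B q) (c : ℂ) (f : 𝓢(Space d, ℂ)) :
    weylOp q (c • f) = c • weylOp q f := by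
  ext x
  simp [hq.weylOp_apply, weylValue_smul]

/-- The Weyl quantization intertwines phase space shifts with translations of the symbol. -/
theorem weylValue_phaseShift (q : PhaseSpace d → ℂ) (z : PhaseSpace d) (f : 𝓢(Space d, ℂ))
    (x : Space d) :
    weylValue q (phaseShift z f) x =
      Complex.exp ((inner ℝ x z.2 : ℝ) * Complex.I) *
        weylValue (fun w => q (z + w)) f (x - z.1) := by
  -- Translating both integration variables by the components of `z` moves the midpoint argument by
  -- `z`; the phases recombine into the modulation at `x`.
  have key : ∀ ξ, weylInner q (phaseShift z f) (x, ξ + z.2) =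
      Complex.exp ((inner ℝ x z.2 : ℝ) * Complex.I) *
        weylInner (fun w => q (z + w)) f (x - z.1, ξ) := by
    intro ξ
    simp only [weylInner]
    rw [← integral_add_right_eq_self _ z.1, ← integral_const_mul]
    congr 1
    ext y
    have h1 : midpointArg (x, ξ + z.2) (y + z.1) = z + midpointArg (x - z.1, ξ) y := by
      refine Prod.ext ?_ ?_
      · simp only [midpointArg, Prod.fst_add]
        module
      · simp only [midpointArg, Prod.snd_add]
        abel
    have h2 : weylPhase (x, ξ + z.2) (y + z.1) *
        Complex.exp ((inner ℝ (y + z.1) z.2 : ℝ) * Complex.I) =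
        Complex.exp ((inner ℝ x z.2 : ℝ) * Complex.I) * weylPhase (x - z.1, ξ) y := by
      simp only [weylPhase]
      rw [← Complex.exp_add, ← Complex.exp_add]
      congr 1
      simp only [inner_sub_left, inner_add_left, inner_add_right]
      push_cast
      ring
    rw [phaseShift_apply, h1, add_sub_cancel_right]
    linear_combination (q (z + midpointArg (x - z.1, ξ) y) * f y) * h2
  rw [weylValue_eq, weylValue_eq, ← integral_add_right_eq_self _ z.2]
  simp_rw [key]
  rw [integral_const_mul, mul_smul_comm]

/-- The Weyl quantization of the constant symbol `1` is the identity. -/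
theorem weylValue_one (f : 𝓢(Space d, ℂ)) (x : Space d) :
    weylValue (fun _ => 1) f x = f x := by
  -- At the frequency `2πξ` the inner integral is the integrand of Fourier inversion; the rescaling
  -- accounts for `(2π)^{-d}`.
  have h1 : ∀ ξ : Space d, weylInner (fun _ => 1) f (x, (2 * Real.pi) • ξ) =
      Complex.exp ((2 * Real.pi * inner ℝ ξ x : ℝ) * Complex.I) •
        FourierTransform.fourier (f : Space d → ℂ) ξ := by
    intro ξ
    rw [Real.fourier_eq', smul_eq_mul, ← integral_const_mul]
    simp only [weylInner, weylPhase]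
    congr 1
    ext y
    rw [smul_eq_mul, ← mul_assoc, ← Complex.exp_add, mul_one]
    congr 2
    simp only [inner_sub_left, inner_smul_right, real_inner_comm x ξ]
    push_cast
    ring
  have h2 : FourierTransformInv.fourierInv (FourierTransform.fourier (f : Space d → ℂ)) x =
      f x := by
    rw [← SchwartzMap.fourier_coe, ← SchwartzMap.fourierInv_coe]
    simp
  have h3 := Measure.integral_comp_smul_of_nonneg (volume : Measure (Space d))
    (fun ξ => weylInner (fun _ => 1) f (x, ξ)) (2 * Real.pi) (hR := by positivity)
  rw [weylValue_eq]
  rw [finrank_euclideanSpace_fin] at h3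
  rw [← h3]
  simp_rw [h1]
  rw [← h2, Real.fourierInv_eq']

end

/-! ### The Japanese bracket -/

theorem japaneseBracket_eq (z : PhaseSpace d) :
    japaneseBracket z = Real.sqrt (1 + (‖z.1‖ ^ 2 + ‖z.2‖ ^ 2)) := by
  rw [japaneseBracket, phaseNorm, Real.sq_sqrt (by positivity)]

theorem one_le_japaneseBracket (z : PhaseSpace d) : 1 ≤ japaneseBracket z := by
  rw [japaneseBracket_eq]
  exact Real.one_le_sqrt.2 (le_add_of_nonneg_right (by positivity))

theorem japaneseBracket_pos (z : PhaseSpace d) : 0 < japaneseBracket z :=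
  one_pos.trans_le (one_le_japaneseBracket z)

theorem japaneseBracket_le_one_add_add (z : PhaseSpace d) :
    japaneseBracket z ≤ 1 + ‖z.1‖ + ‖z.2‖ := by
  rw [japaneseBracket_eq]
  refine Real.sqrt_le_iff.2 ⟨by positivity, ?_⟩
  have := norm_nonneg z.1
  have := norm_nonneg z.2
  nlinarith [mul_nonneg (norm_nonneg z.1) (norm_nonneg z.2)]

theorem japaneseBracket_le (z : PhaseSpace d) : japaneseBracket z ≤ 2 * (1 + ‖z‖) := by
  linarith [japaneseBracket_le_one_add_add z, norm_fst_le z, norm_snd_le z]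

theorem one_add_norm_le (z : PhaseSpace d) : 1 + ‖z‖ ≤ 2 * japaneseBracket z := by
  have h : ‖z‖ ≤ japaneseBracket z := by
    rw [japaneseBracket_eq]
    refine max_le ?_ ?_ <;> refine Real.le_sqrt_of_sq_le ?_ <;>
      linarith [sq_nonneg ‖z.1‖, sq_nonneg ‖z.2‖]
  linarith [one_le_japaneseBracket z]

theorem japaneseBracket_add_le (z w : PhaseSpace d) :
    japaneseBracket (z + w) ≤ 4 * (1 + ‖w‖) * japaneseBracket z := by
  have h1 := japaneseBracket_le (z + w)
  have h2 := one_add_norm_le z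
  have h3 := norm_add_le z w
  have h4 : 1 + ‖z + w‖ ≤ (1 + ‖w‖) * (1 + ‖z‖) := by
    nlinarith [mul_nonneg (norm_nonneg z) (norm_nonneg w)]
  have h5 : (1 + ‖w‖) * (1 + ‖z‖) ≤ (1 + ‖w‖) * (2 * japaneseBracket z) := by gcongr
  linarith

/-- Peetre's inequality. -/
theorem japaneseBracket_add_rpow_le (s : ℝ) (z w : PhaseSpace d) :
    japaneseBracket (z + w) ^ s ≤ (4 * (1 + ‖w‖)) ^ |s| * japaneseBracket z ^ s := by
  have hz := japaneseBracket_pos z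
  have hzw := japaneseBracket_pos (z + w)
  have hw : 0 < 4 * (1 + ‖w‖) := by positivity
  rcases le_total 0 s with hs | hs
  · rw [abs_of_nonneg hs, ← Real.mul_rpow hw.le hz.le]
    exact Real.rpow_le_rpow hzw.le (japaneseBracket_add_le z w) hs
  · have h1 : japaneseBracket z ≤ 4 * (1 + ‖w‖) * japaneseBracket (z + w) := by
      simpa using japaneseBracket_add_le (z + w) (-w)
    have h2 := Real.rpow_le_rpow_of_nonpos hz h1 hs
    rw [Real.mul_rpow hw.le hzw.le] at h2
    rw [abs_of_nonpos hs, Real.rpow_neg hw.le]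
    rwa [← div_eq_inv_mul, le_div_iff₀' (by positivity)]

/-! ### Shubin symbols -/

theorem ShubinClass.conj {m : ℝ} {a : PhaseSpace d → ℂ} (ha : ShubinClass m a) :
    ShubinClass m fun z => conj (a z) := by
  refine ⟨(Complex.conjCLE : ℂ →L[ℝ] ℂ).contDiff.comp ha.1, fun n => ?_⟩
  obtain ⟨C, hC⟩ := ha.2 n
  refine ⟨C, fun z => ?_⟩
  have := Complex.conjLIE.norm_iteratedFDeriv_comp_left (𝕜 := ℝ) a z n
  exact this.le.trans (hC z)

theorem ShubinClass.exists_symbolBound {m : ℝ} {a : PhaseSpace d → ℂ} (ha : ShubinClass m a) :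
    ∃ (M : ℕ) (B : ℕ → ℝ), SymbolBound M B a := by
  choose C hC using ha.2
  refine ⟨⌈|m|⌉₊, fun n => |C n| * 2 ^ ⌈|m|⌉₊, ha.1, fun n w => (hC n w).trans ?_⟩
  have h1 := one_le_japaneseBracket w
  have h2 : japaneseBracket w ^ (m - n) ≤ japaneseBracket w ^ ⌈|m|⌉₊ := by
    rw [← Real.rpow_natCast]
    refine Real.rpow_le_rpow_of_exponent_le h1 ?_
    linarith [Nat.le_ceil |m|, le_abs_self m, Nat.cast_nonneg (α := ℝ) n]
  have h3 : japaneseBracket w ^ ⌈|m|⌉₊ ≤ (2 * (1 + ‖w‖)) ^ ⌈|m|⌉₊ :=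
    pow_le_pow_left₀ (by linarith) (japaneseBracket_le w) _
  calc _ ≤ |C n| * japaneseBracket w ^ (m - n) := by
        gcongr
        exact le_abs_self _
    _ ≤ |C n| * (2 * (1 + ‖w‖)) ^ ⌈|m|⌉₊ := by gcongr; exact h2.trans h3
    _ = _ := by rw [mul_pow]; ring

/-- These constants depend on `z`. They serve only to identify and split the operator; uniform
bounds come from the normalized difference below. -/
theorem SymbolBound.translate {M : ℕ} {B : ℕ → ℝ} {q : PhaseSpace d → ℂ} (hq : SymbolBound M B q)
    (z : PhaseSpace d) :
    SymbolBound M (fun n => B n * (1 + ‖z‖) ^ M) fun w => q (z + w) := by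
  refine ⟨hq.1.comp (contDiff_const.add contDiff_id), fun n w => ?_⟩
  rw [iteratedFDeriv_comp_add_left]
  have h0 := hq.nonneg n
  refine (hq.2 n (z + w)).trans ?_
  rw [mul_assoc, ← mul_pow]
  gcongr
  nlinarith [norm_add_le z w, mul_nonneg (norm_nonneg z) (norm_nonneg w)]

/-- Where `b ∈ G^m` is elliptic, the translates of `b` are constant up to relative errors of the
order `⟨z⟩⁻¹`, uniformly in `z`. -/
theorem ShubinClass.exists_symbolBound_translate {m : ℝ} {b : PhaseSpace d → ℂ}
    (hb : ShubinClass m b) {ε : ℝ} (hε : 0 < ε) : ∃ (M : ℕ) (B : ℕ → ℝ), ∀ z : PhaseSpace d,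
      ε * japaneseBracket z ^ m ≤ ‖b z‖ →
        SymbolBound M B fun w => (japaneseBracket z * (b z)⁻¹) • (b (z + w) - b z) := by
  choose C hC using hb.2
  set L := ⌈|m - 1|⌉₊
  -- `L` is Peetre's exponent at order `m - 1`. The additional power and `C 1` come from the mean
  -- value estimate of the undifferentiated difference.
  refine ⟨L + 1, fun n => ε⁻¹ * (|C n| + |C 1|) * 4 ^ L, fun z hz => ?_⟩
  have hJ := japaneseBracket_pos z
  have hbz : 0 < ‖b z‖ := lt_of_lt_of_le (by positivity) hz
  -- The only use of ellipticity beyond `b z ≠ 0`: the normalization exactly offsets the size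
  -- `⟨z⟩^(m-1)` of the first derivatives.
  have hc : ‖(japaneseBracket z : ℂ) * (b z)⁻¹‖ * japaneseBracket z ^ (m - 1) ≤ ε⁻¹ := by
    rw [norm_mul, norm_inv, Complex.norm_real, Real.norm_of_nonneg hJ.le,
      Real.rpow_sub_one hJ.ne']
    calc _ = ‖b z‖⁻¹ * japaneseBracket z ^ m := by field_simp
      _ ≤ _ := by
        rw [inv_mul_le_iff₀ hbz, ← div_eq_mul_inv, le_div_iff₀ hε]
        linarith
  have hD : ∀ n : ℕ, 1 ≤ n → ∀ w : PhaseSpace d, ‖iteratedFDeriv ℝ n b (z + w)‖ ≤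
      |C n| * (4 * (1 + ‖w‖)) ^ L * japaneseBracket z ^ (m - 1) := by
    intro n hn w
    have hn' : (1 : ℝ) ≤ n := by exact_mod_cast hn
    have h4 : 1 ≤ 4 * (1 + ‖w‖) := by linarith [norm_nonneg w]
    calc _ ≤ |C n| * japaneseBracket (z + w) ^ (m - n) :=
          (hC n (z + w)).trans (by
            have := (japaneseBracket_pos (z + w)).le
            gcongr; exact le_abs_self _)
      _ ≤ |C n| * japaneseBracket (z + w) ^ (m - 1) := by
          gcongr
          exact one_le_japaneseBracket _
      _ ≤ |C n| * ((4 * (1 + ‖w‖)) ^ L * japaneseBracket z ^ (m - 1)) := by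
          gcongr
          refine (japaneseBracket_add_rpow_le _ z w).trans ?_
          gcongr
          rw [← Real.rpow_natCast]
          exact Real.rpow_le_rpow_of_exponent_le h4 (Nat.le_ceil _)
      _ = _ := by ring
  have hsm : ContDiff ℝ ∞ fun w => b (z + w) - b z :=
    (hb.1.comp (contDiff_const.add contDiff_id)).sub contDiff_const
  have hB : ∀ n : ℕ, ∀ w : PhaseSpace d, ‖iteratedFDeriv ℝ n (fun w => b (z + w) - b z) w‖ ≤
      (|C n| + |C 1|) * (4 ^ L * (1 + ‖w‖) ^ (L + 1)) * japaneseBracket z ^ (m - 1) := by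
    intro n w
    have hw := norm_nonneg w
    rcases Nat.eq_zero_or_pos n with rfl | hn
    · rw [norm_iteratedFDeriv_zero]
      have hmv := (convex_closedBall z ‖w‖).norm_image_sub_le_of_norm_fderiv_le (𝕜 := ℝ) (f := b)
        (C := |C 1| * (4 * (1 + ‖w‖)) ^ L * japaneseBracket z ^ (m - 1)) (x := z) (y := z + w)
        (fun y _ => hb.1.differentiable (by simp) y) (fun y hy => by
          have h1 := hD 1 le_rfl (y - z)
          rw [norm_iteratedFDeriv_one, add_sub_cancel] at h1
          refine h1.trans ?_
          have : ‖y - z‖ ≤ ‖w‖ := by simpa [dist_eq_norm] using hy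
          gcongr) (by simp) (by simp)
      refine hmv.trans ?_
      rw [add_sub_cancel_left]
      calc _ = |C 1| * (4 ^ L * (1 + ‖w‖) ^ L * ‖w‖) * japaneseBracket z ^ (m - 1) := by
            rw [mul_pow]; ring
        _ ≤ (|C 0| + |C 1|) * (4 ^ L * (1 + ‖w‖) ^ L * (1 + ‖w‖)) *
            japaneseBracket z ^ (m - 1) := by
            gcongr
            · linarith [abs_nonneg (C 0)]
            · linarith
        _ = _ := by ring
    · obtain ⟨n, rfl⟩ := Nat.exists_eq_succ_of_ne_zero hn.ne'
      have e1 : ‖iteratedFDeriv ℝ (n + 1) (fun w => b (z + w) - b z) w‖ =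
          ‖iteratedFDeriv ℝ (n + 1) b (z + w)‖ := by
        rw [← iteratedFDeriv_comp_add_left, ← norm_iteratedFDeriv_fderiv,
          ← norm_iteratedFDeriv_fderiv (f := fun w => b (z + w))]
        congr 2
        ext1 w
        exact fderiv_sub_const _
      rw [Nat.succ_eq_add_one, e1]
      refine (hD (n + 1) (by omega) w).trans ?_
      rw [mul_pow]
      gcongr
      · linarith [abs_nonneg (C 1)]
      · linarith
      · omega
  refine ⟨hsm.const_smul _, fun n w => ?_⟩
  have e : (fun w => ((japaneseBracket z : ℂ) * (b z)⁻¹) • (b (z + w) - b z)) =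
      ((japaneseBracket z : ℂ) * (b z)⁻¹) • fun w => b (z + w) - b z := rfl
  rw [e, iteratedFDeriv_const_smul_apply (hsm.of_le (by exact_mod_cast le_top)).contDiffAt,
    norm_smul]
  calc _ ≤ ‖(japaneseBracket z : ℂ) * (b z)⁻¹‖ * ((|C n| + |C 1|) *
          (4 ^ L * (1 + ‖w‖) ^ (L + 1)) * japaneseBracket z ^ (m - 1)) := by
        gcongr
        exact hB n w
    _ = (‖(japaneseBracket z : ℂ) * (b z)⁻¹‖ * japaneseBracket z ^ (m - 1)) *
          ((|C n| + |C 1|) * (4 ^ L * (1 + ‖w‖) ^ (L + 1))) := by ring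
    _ ≤ ε⁻¹ * ((|C n| + |C 1|) * (4 ^ L * (1 + ‖w‖) ^ (L + 1))) := by gcongr
    _ = _ := by ring

/-! ### A parametrix acting on the window -/

theorem symbolBound_const (c : ℂ) :
    SymbolBound 0 (fun _ => ‖c‖) (fun _ : PhaseSpace d => c) := by
  refine ⟨contDiff_const, fun n w => ?_⟩
  rcases Nat.eq_zero_or_pos n with rfl | hn
  · simp
  · rw [iteratedFDeriv_const_of_ne hn.ne']
    simp

/-- On the set where `b ∈ G^m` is elliptic, `b(z + ·)^w h = φ` can be solved for `h` up to an error
of the order `⟨z⟩⁻ⁿ`. -/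
theorem ShubinClass.exists_parametrix {m : ℝ} {b : PhaseSpace d → ℂ} (hb : ShubinClass m b)
    {ε : ℝ} (hε : 0 < ε) (φ : 𝓢(Space d, ℂ)) (n : ℕ) :
    ∃ h r : PhaseSpace d → 𝓢(Space d, ℂ),
      (∀ z, ε * japaneseBracket z ^ m ≤ ‖b z‖ →
        weylOp (fun w => b (z + w)) (h z) = φ + r z) ∧
      (∀ j, ∃ C, 0 ≤ C ∧ ∀ z, ε * japaneseBracket z ^ m ≤ ‖b z‖ →
        schwartzNorm j (h z) ≤ C * ‖b z‖⁻¹) ∧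
      (∀ j, ∃ C, 0 ≤ C ∧ ∀ z, ε * japaneseBracket z ^ m ≤ ‖b z‖ →
        schwartzNorm j (r z) ≤ C * (japaneseBracket z ^ n)⁻¹) := by
  obtain ⟨M, B, hQ⟩ := hb.exists_symbolBound_translate hε
  obtain ⟨M', B', hbB⟩ := hb.exists_symbolBound
  let Q : PhaseSpace d → PhaseSpace d → ℂ :=
    fun z w => (japaneseBracket z * (b z)⁻¹) • (b (z + w) - b z)
  -- The frozen symbol `b z` quantizes to a scalar, so the operator is `b z` times a perturbation of
  -- the identity of size `⟨z⟩⁻¹`.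
  have hexp : ∀ z, ε * japaneseBracket z ^ m ≤ ‖b z‖ → ∀ g : 𝓢(Space d, ℂ),
      weylOp (fun w => b (z + w)) g =
        b z • (g + ((japaneseBracket z : ℂ)⁻¹) • weylOp (Q z) g) := by
    intro z hz g
    have hJ : (japaneseBracket z : ℂ) ≠ 0 := by exact_mod_cast (japaneseBracket_pos z).ne'
    have hbz : b z ≠ 0 := by
      have := japaneseBracket_pos z
      exact norm_pos_iff.1 (lt_of_lt_of_le (by positivity) hz)
    ext x
    have e1 : (fun w => b (z + w)) =
        fun w => b z * (1 + (japaneseBracket z : ℂ)⁻¹ * Q z w) := by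
      ext w
      simp only [Q, smul_eq_mul]
      field_simp
      ring
    have hs : SymbolBound M (fun n => ‖(japaneseBracket z : ℂ)⁻¹‖ * B n)
        fun w => (japaneseBracket z : ℂ)⁻¹ * Q z w := by
      refine ⟨contDiff_const.mul (hQ z hz).1, fun n w => ?_⟩
      have : (fun w => (japaneseBracket z : ℂ)⁻¹ * Q z w) =
          (japaneseBracket z : ℂ)⁻¹ • Q z := rfl
      rw [this, iteratedFDeriv_const_smul_apply
        ((hQ z hz).1.of_le (by exact_mod_cast le_top)).contDiffAt, norm_smul, mul_assoc]
      gcongr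
      exact (hQ z hz).2 n w
    rw [(hbB.translate z).weylOp_apply, e1, weylValue_const_mul,
      (symbolBound_const 1).weylValue_symbol_add hs, weylValue_one, weylValue_const_mul]
    simp only [smul_apply, add_apply, smul_eq_mul]
    rw [(hQ z hz).weylOp_apply]
  induction n with
  | zero =>
    refine ⟨fun _ => 0, fun _ => -φ, fun z _ => ?_, fun j => ⟨0, le_rfl, fun z _ => by simp⟩,
      fun j => ⟨schwartzNorm j φ, schwartzNorm_nonneg j φ, fun z _ => by simp⟩⟩
    have := (hbB.translate z).weylOp_smul 0 0
    simpa using this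
  | succ n ih =>
    obtain ⟨h, r, h1, h2, h3⟩ := ih
    -- One more Neumann term: subtracting `(b z)⁻¹ r` cancels `r` to leading order and leaves
    -- `-⟨z⟩⁻¹ Q_z^w r`, a power of `⟨z⟩⁻¹` better.
    refine ⟨fun z => h z + (-(b z)⁻¹) • r z,
      fun z => (-(japaneseBracket z : ℂ)⁻¹) • weylOp (Q z) (r z), fun z hz => ?_, fun j => ?_,
      fun j => ?_⟩
    · have hbz : b z ≠ 0 := by
        have := japaneseBracket_pos z
        exact norm_pos_iff.1 (lt_of_lt_of_le (by positivity) hz)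
      rw [(hbB.translate z).weylOp_add, (hbB.translate z).weylOp_smul, h1 z hz, hexp z hz (r z),
        smul_smul, neg_mul, inv_mul_cancel₀ hbz]
      module
    · obtain ⟨C, hC, h2⟩ := h2 j
      obtain ⟨C', hC', h3⟩ := h3 j
      refine ⟨C + C', by positivity, fun z hz => (map_add_le_add _ _ _).trans ?_⟩
      rw [map_smul_eq_mul, norm_neg, norm_inv, add_mul]
      refine add_le_add (h2 z hz) ?_
      rw [mul_comm]
      gcongr
      refine (h3 z hz).trans (mul_le_of_le_one_right hC' ?_)
      exact inv_le_one_of_one_le₀ (one_le_pow₀ (one_le_japaneseBracket z))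
    · obtain ⟨D, j', hD, hop⟩ := exists_schwartzNorm_weylOp_le (d := d) M B j
      obtain ⟨C', hC', h3⟩ := h3 j'
      refine ⟨D * C', by positivity, fun z hz => ?_⟩
      have hJ := japaneseBracket_pos z
      rw [map_smul_eq_mul, norm_neg, norm_inv, Complex.norm_real, Real.norm_of_nonneg hJ.le]
      calc _ ≤ (japaneseBracket z)⁻¹ * (D * (C' * (japaneseBracket z ^ n)⁻¹)) := by
            gcongr
            refine (hop _ (hQ z hz) _).trans ?_
            gcongr
            exact h3 z hz
        _ = _ := by rw [pow_succ, mul_inv]; ring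

/-! ### Tempered distributions -/

theorem schwartzNorm_conjSchwartz_le (j : ℕ) (g : 𝓢(Space d, ℂ)) :
    schwartzNorm j (conjSchwartz g) ≤ schwartzNorm j g := by
  refine schwartzNorm_le (schwartzNorm_nonneg j g) fun k hk n hn x => ?_
  have := Complex.conjLIE.norm_iteratedFDeriv_comp_left (𝕜 := ℝ) g x n
  exact (congrArg (‖x‖ ^ k * ·) this).le.trans (pow_mul_le_schwartzNorm hk hn g x)

/-- Continuity bounds `u` by finitely many seminorms; one index dominating all their orders
suffices. -/
theorem exists_norm_apply_le_schwartzNorm (u : 𝓢'(Space d, ℂ)) :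
    ∃ (C : ℝ) (j : ℕ), 0 ≤ C ∧ ∀ g : 𝓢(Space d, ℂ), ‖u g‖ ≤ C * schwartzNorm j g := by
  let p : Seminorm ℂ 𝓢(Space d, ℂ) :=
    (normSeminorm ℂ ℂ).comp (u : 𝓢(Space d, ℂ) →L[ℂ] ℂ).toLinearMap
  have hp : Continuous p := by
    have : Continuous fun g : 𝓢(Space d, ℂ) => ‖u g‖ := (map_continuous u).norm
    exact this
  obtain ⟨s, C, -, h⟩ := Seminorm.bound_of_continuous (schwartz_withSeminorms ℂ (Space d) ℂ) p hp
  refine ⟨C, s.sup fun m => max m.1 m.2, C.2, fun g => (Seminorm.le_def.1 h g).trans ?_⟩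
  refine mul_le_mul_of_nonneg_left ?_ C.2
  refine Seminorm.le_def.1 (Finset.sup_mono fun m hm => ?_) g
  have := Finset.le_sup (f := fun m : ℕ × ℕ => max m.1 m.2) hm
  exact Finset.mem_Iic.2 (Prod.mk_le_mk.2
    ⟨(le_max_left _ _).trans this, (le_max_right _ _).trans this⟩)

theorem pairing_add (u : 𝓢'(Space d, ℂ)) (g h : 𝓢(Space d, ℂ)) :
    pairing u (g + h) = pairing u g + pairing u h := by
  have : conjSchwartz (g + h) = conjSchwartz g + conjSchwartz h := by
    ext y; simp [conjSchwartz_apply]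
  rw [pairing, this, map_add]
  rfl

theorem exists_norm_pairing_phaseShift_le (u : 𝓢'(Space d, ℂ)) :
    ∃ (C : ℝ) (K j : ℕ), 0 ≤ C ∧ ∀ (g : 𝓢(Space d, ℂ)) (z : PhaseSpace d),
      ‖pairing u (phaseShift z g)‖ ≤ C * japaneseBracket z ^ K * schwartzNorm j g := by
  obtain ⟨C, j, hC, h⟩ := exists_norm_apply_le_schwartzNorm u
  obtain ⟨D, K, j', hD, h'⟩ := exists_schwartzNorm_phaseShift_le (d := d) j
  refine ⟨C * (D * 2 ^ K), K, j', by positivity, fun g z => ?_⟩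
  have hN := schwartzNorm_nonneg j' g
  calc _ ≤ C * schwartzNorm j (conjSchwartz (phaseShift z g)) := h _
    _ ≤ C * (D * (1 + ‖z‖) ^ K * schwartzNorm j' g) := by
        gcongr
        exact (schwartzNorm_conjSchwartz_le _ _).trans (h' z g)
    _ ≤ C * (D * (2 * japaneseBracket z) ^ K * schwartzNorm j' g) := by
        gcongr
        exact one_add_norm_le z
    _ = _ := by rw [mul_pow]; ring

/-! ### Decay on the elliptic set and the inclusion -/

/-- If `a^w u ∈ 𝓢`, the short-time Fourier transform of `u` decays rapidly on the set where `a` is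
elliptic. -/
theorem exists_pow_mul_norm_stft_le {m : ℝ} {a : PhaseSpace d → ℂ} (ha : ShubinClass m a)
    {u : 𝓢'(Space d, ℂ)} (hu : WeylMemSchwartz a u) {ε : ℝ} (hε : 0 < ε) (φ : 𝓢(Space d, ℂ))
    (n : ℕ) : ∃ C, ∀ z, ε * japaneseBracket z ^ m ≤ ‖a z‖ →
      japaneseBracket z ^ n * ‖stft φ u z‖ ≤ C := by
  obtain ⟨f, hf⟩ := hu
  obtain ⟨Cu, K, ju, hCu, hub⟩ := exists_norm_pairing_phaseShift_le u
  set L := ⌈|m|⌉₊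
  obtain ⟨Cf, jf, hCf, hfb⟩ := exists_norm_innerPhaseShift_le (d := d) (n + L)
  -- Duality puts the conjugate symbol on the test function. The order `n + K` outweighs the growth
  -- `⟨z⟩^K` of `u` on phase space shifts; likewise `n + L` above outweighs `|a(z)|⁻¹ ≤ ε⁻¹⟨z⟩^L`.
  obtain ⟨h, r, hhr, hh, hr⟩ := ha.conj.exists_parametrix hε φ (n + K)
  obtain ⟨Ch, hCh, hh⟩ := hh jf
  obtain ⟨Cr, hCr, hr⟩ := hr ju
  obtain ⟨M, B, hbB⟩ := ha.conj.exists_symbolBound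
  simp only [RCLike.norm_conj] at hh hr hhr
  refine ⟨Cf * (schwartzNorm jf f * (Ch * ε⁻¹)) + Cu * Cr, fun z hz => ?_⟩
  have hJ := japaneseBracket_pos z
  have hJ1 := one_le_japaneseBracket z
  have hbz : 0 < ‖a z‖ := lt_of_lt_of_le (by positivity) hz
  have hNf := schwartzNorm_nonneg jf f
  have hcov : weylOp (fun w => conj (a w)) (phaseShift z (h z)) =
      phaseShift z φ + phaseShift z (r z) := by
    rw [← phaseShift_add, ← hhr z hz]
    ext x
    rw [hbB.weylOp_apply, weylValue_phaseShift, phaseShift_apply,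
      (hbB.translate z).weylOp_apply]
  have hsplit : stft φ u z =
      innerPhaseShift f (h z) z - pairing u (phaseShift z (r z)) := by
    rw [← pairing_toTemperedDistributionCLM, ← hf, weylDual, hcov, pairing_add, stft]
    ring
  have e1 : japaneseBracket z ^ n * ‖innerPhaseShift f (h z) z‖ ≤
      Cf * (schwartzNorm jf f * (Ch * ε⁻¹)) := by
    have hinv : ‖a z‖⁻¹ ≤ ε⁻¹ * japaneseBracket z ^ L := by
      have hJm : (japaneseBracket z ^ m)⁻¹ ≤ japaneseBracket z ^ L := by
        rw [← Real.rpow_neg hJ.le, ← Real.rpow_natCast]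
        exact Real.rpow_le_rpow_of_exponent_le hJ1 ((neg_le_abs m).trans (Nat.le_ceil _))
      calc ‖a z‖⁻¹ ≤ (ε * japaneseBracket z ^ m)⁻¹ := by gcongr
        _ = ε⁻¹ * (japaneseBracket z ^ m)⁻¹ := mul_inv _ _
        _ ≤ _ := by gcongr
    refine le_of_mul_le_mul_left ?_ (pow_pos hJ L)
    calc _ = japaneseBracket z ^ (n + L) * ‖innerPhaseShift f (h z) z‖ := by ring
      _ ≤ (1 + ‖z.1‖ + ‖z.2‖) ^ (n + L) * ‖innerPhaseShift f (h z) z‖ := by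
          gcongr
          exact japaneseBracket_le_one_add_add z
      _ ≤ Cf * (schwartzNorm jf f * schwartzNorm jf (h z)) := hfb f (h z) z
      _ ≤ Cf * (schwartzNorm jf f * (Ch * (ε⁻¹ * japaneseBracket z ^ L))) := by
          gcongr
          exact (hh z hz).trans (by gcongr)
      _ = _ := by ring
  have e2 : japaneseBracket z ^ n * ‖pairing u (phaseShift z (r z))‖ ≤ Cu * Cr := by
    calc _ ≤ japaneseBracket z ^ n * (Cu * japaneseBracket z ^ K *
            (Cr * (japaneseBracket z ^ (n + K))⁻¹)) := by
          gcongr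
          refine (hub _ z).trans ?_
          gcongr
          exact hr z hz
      _ = Cu * Cr := by
          rw [pow_add]
          field_simp
  calc _ ≤ japaneseBracket z ^ n * (‖innerPhaseShift f (h z) z‖ +
          ‖pairing u (phaseShift z (r z))‖) := by
        rw [hsplit]
        gcongr
        exact norm_sub_le _ _
    _ ≤ _ := by rw [mul_add]; exact add_le_add e1 e2

/-- Ellipticity holds only for `|z| ≥ A`; on the remaining bounded part of the cone, polynomial
growth already gives a bound. -/
theorem exists_pow_mul_norm_stft_le_of_phaseNorm_le (u : 𝓢'(Space d, ℂ)) (φ : 𝓢(Space d, ℂ))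
    (n : ℕ) (A : ℝ) : ∃ C, ∀ z, phaseNorm z ≤ A →
      japaneseBracket z ^ n * ‖stft φ u z‖ ≤ C := by
  obtain ⟨C, K, j, hC, h⟩ := exists_norm_pairing_phaseShift_le u
  refine ⟨Real.sqrt (1 + A ^ 2) ^ n * (C * Real.sqrt (1 + A ^ 2) ^ K * schwartzNorm j φ),
    fun z hz => ?_⟩
  have hJ := japaneseBracket_pos z
  have hJA : japaneseBracket z ≤ Real.sqrt (1 + A ^ 2) := by
    have : 0 ≤ phaseNorm z := Real.sqrt_nonneg _
    rw [japaneseBracket]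
    gcongr
  have hN := schwartzNorm_nonneg j φ
  calc _ ≤ japaneseBracket z ^ n * (C * japaneseBracket z ^ K * schwartzNorm j φ) := by
        gcongr
        exact h φ z
    _ ≤ _ := by gcongr

theorem stftWaveFrontSet_subset (φ : 𝓢(Space d, ℂ)) (u : 𝓢'(Space d, ℂ)) :
    stftWaveFrontSet φ u ⊆ waveFrontSet u := by
  rintro z₀ ⟨hz₀, hdec⟩
  refine ⟨hz₀, fun m a ha hu => ⟨hz₀, ?_⟩⟩
  rintro ⟨A, ε, Γ, hA, hε, hΓ, hzΓ, hell⟩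
  refine hdec ⟨Γ, hΓ, hzΓ, fun n => ?_⟩
  obtain ⟨C₁, h₁⟩ := exists_pow_mul_norm_stft_le ha hu hε φ n
  obtain ⟨C₂, h₂⟩ := exists_pow_mul_norm_stft_le_of_phaseNorm_le u φ n A
  refine ⟨max C₁ C₂, ?_⟩
  rintro _ ⟨z, hz, rfl⟩
  rcases le_total A (phaseNorm z) with h | h
  · exact (h₁ z (hell z hz h)).trans (le_max_left _ _)
  · exact (h₂ z h).trans (le_max_right _ _)

end GlobalWF

end

/-- For every tempered distribution `u` on `ℝ^d` and every nonzero Schwartz window `φ`,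
`WF'(u) ⊆ WF(u)`. -/
theorem mainTheorem5 (d : ℕ) (u : 𝓢'(GlobalWF.Space d, ℂ)) (φ : 𝓢(GlobalWF.Space d, ℂ))
    (hφ : φ ≠ 0) :
    GlobalWF.stftWaveFrontSet φ u ⊆ GlobalWF.waveFrontSet u :=
  GlobalWF.stftWaveFrontSet_subset φ u
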